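/- Let $k$ be a field and $A$ a Hopf algebra over $k$ with antipode $S$ and a coquasitriangular structure $\mathcal R:A\otimes A\to k$, i.e. $\mathcal R$ is convolution-invertible, $b_{(1)}a_{(1)}\mathcal R(a_{(2)}\otimes b_{(2)})=\mathcal R(a_{(1)}\otimes b_{(1)})a_{(2)}b_{(2)}$, $\mathcal R(ab\otimes c)=\mathcal R(a\otimes c_{(1)})\mathcal R(b\otimes c_{(2)})$ and $\mathcal R(a\otimes bc)=\mathcal R(a_{(1)}\otimes c)\mathcal R(a_{(2)}\otimes b)$. Put $\mathcal Q(a\otimes b)=\mathcal R(b_{(1)}\otimes a_{(1)})\mathcal R(a_{(2)}\otimes b_{(2)})$. A subcoalgebra $\mathcal L\subseteq A$ is a right $A$-comodule under $\mathrm{Ad}_R(x)=x_{(\bar 0)}\otimes x_{(\bar 1)}=x_{(2)}\otimes (Sx_{(1)})x_{(3)}$; the categorical braiding of right comodules is $\Psi(v\otimes w)=w_{(\bar 0)}\otimes v_{(\bar 0)}\,\mathcal R(v_{(\bar 1)}\otimes w_{(\bar 1)})$. The braided-Lie bracket of $\mathcal L$ is $[x,y]=y_{(\bar 0)}\,\mathcal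 Q(x\otimes y_{(\bar 1)})$, the associated braiding is $\tilde\Psi=([\ ,\ ]\otimes\mathrm{id})(\mathrm{id}\otimes\Psi)(\Delta\otimes\mathrm{id})$, and the braided enveloping algebra is $U(\mathcal L)=T\mathcal L/\langle \mathrm{image}(\mathrm{id}-\tilde\Psi)\rangle$. For a finite-dimensional vector space $V$, the Koszul dual of a quadratic algebra $TV/\langle \mathcal S\rangle$, $\mathcal S\subseteq V\otimes V$, is $TV^*/\langle \mathcal S^\perp\rangle$, with respect to the pairing $\langle f\otimes g,v\otimes w\rangle=f(v)g(w)$. **(A)** Let $\mathcal L\subseteq A$ be a finite-dimensional subcoalgebra. The right crossed module structure on $\mathcal L$ given by $\mathrm{Ad}_R$ and $x\triangleleft a=x_{(2)}\mathcal R(a_{(1)}\otimes x_{(1)})\mathcal R(x_{(3)}\otimes a_{(2)})$ dualises to a left action $(a\triangleright f)(x)=f(x\triangleleft a)$ and a left coaction $f\mapsto f_{(-1)}\otimes f_{(0)}$, $f_{(-1)}f_{(0)}(x)=f(x_{(\bar 0)})x_{(\bar 1)}$, on $\mathcal L^*$, with braiding $\Psi_{\mathcal L^*}(f\otimes g)=f_{(-1)}\triangleright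 g\otimes f_{(0)}$. For a subspace $W\subseteq\mathcal L^*$ let $\Lambda_{quad}(W)=TW/\langle \ker(\mathrm{id}-\Psi_{\mathcal L^*})\cap (W\otimes W)\rangle$. 1. The algebras $U(\mathcal L)$ and $\Lambda_{quad}(\mathcal L^*)$ are Koszul dual to each other, by isomorphisms that are the canonical ones on generators. Moreover, for the right-handed bicovariant calculus with invariant 1-forms $\Lambda^1=\{\mathcal Q(\,\cdot\otimes a)|_{\mathcal L}: a\in A,\ \epsilon(a)=0\}\subseteq\mathcal L^*$, the restriction $\mathcal L\to(\Lambda^1)^*$ extends to a surjective algebra map from $U(\mathcal L)$ to the Koszul dual of $\Lambda_{quad}(\Lambda^1)$, whose kernel is the ideal generated by $\{x\in\mathcal L: f(x)=0\ \forall f\in\Lambda^1\}$. In particular it is an isomorphism if $\Lambda^1=\mathcal L^*$. 2. Let the braided-Killing form be $K(a,b)=\mathrm{ev}\,\Psi\big(\sum_i[a,[b,e_i]]\otimes f^i\big)$, where $\{e_i\}$ is a basis of $\mathcal L$ with dual basis $\{f^i\}$, and where $\mathcal L^*$ is a right comodule by $f_{(\bar 0)}(x)f_{(\bar 1)}=f(x_{(\bar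 0)})Sx_{(\bar 1)}$. Then for every basis and all $a,b\in\mathcal L$ $$K(a,b)=\sum_i u(e_{i(\bar 1)(1)})\,\mathcal Q(a\otimes e_{i(\bar 1)(2)})\,\mathcal Q(b\otimes e_{i(\bar 1)(3)})\,\langle f^i,e_{i(\bar 0)}\rangle,\qquad u(c)=\mathcal R(c_{(2)}\otimes Sc_{(1)}).$$ **(B)** Let $t\in M_n(A)$ be a matrix corepresentation, $\Delta t^i{}_j=\sum_a t^i{}_a\otimes t^a{}_j$, $\epsilon(t^i{}_j)=\delta^i{}_j$, and $\mathcal L$ the subcoalgebra spanned by the $t^i{}_j$. Let $R^i{}_j{}^k{}_l=\mathcal R(t^i{}_j\otimes t^k{}_l)$, regarded as $R\in M_n\otimes M_n$, and $\tilde R^i{}_j{}^k{}_l=\mathcal R(t^i{}_j\otimes St^k{}_l)$. Then $R$ is invertible and, summing over repeated indices, $$[t^i{}_j,t^k{}_l]=t^{k_2}{}_{k_3}R^{-1}{}^{k_1}{}_{k_2}{}^i{}_{i_1}R^{k_3}{}_{k_4}{}^{i_1}{}_{i_2}R^{i_2}{}_{i_3}{}^{k_4}{}_l\tilde R^{i_3}{}_j{}^k{}_{k_1},$$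 $$\Psi(t^i{}_j\otimes t^k{}_l)=t^{k_2}{}_{k_3}\otimes t^{i_2}{}_{i_3}R^i{}_{i_1}{}^{k_1}{}_{k_2}R^{-1}{}^{i_1}{}_{i_2}{}^{k_3}{}_{k_4}R^{i_3}{}_{i_4}{}^{k_4}{}_l\tilde R^{i_4}{}_j{}^k{}_{k_1}.$$ The algebra $U(\mathcal L)$ is generated by the $t^i{}_j$, with product denoted $\bullet$, and its defining relations are $$t^i{}_j\bullet t^k{}_l=t^{k_2}{}_{k_3}\bullet t^{i_2}{}_{i_3}R^{-1}{}^{k_1}{}_{k_2}{}^i{}_{i_1}R^{k_3}{}_{k_4}{}^{i_1}{}_{i_2}R^{i_3}{}_{i_4}{}^{k_4}{}_l\tilde R^{i_4}{}_j{}^k{}_{k_1}$$ together with the linear relations (if any) that hold among the $t^i{}_j$ in $A$. The exchange relations can be written as $R_{21}t_1\bullet Rt_2=t_2\bullet R_{21}t_1R$: if $B(R)$ is the algebra of braided matrices, with generators $u^i{}_j$ and relations $R_{21}u_1Ru_2=u_2R_{21}u_1R$, then $t$ satisfies these relations in $U(\mathcal L)$ and $u^i{}_j\mapsto t^i{}_j$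 is a surjection $B(R)\to U(\mathcal L)$ whose kernel is the ideal generated by the elements $\sum c_{ij}u^i{}_j$ with $\sum c_{ij}t^i{}_j=0$ in $A$. In particular $U(\mathcal L)\cong B(R)$ if the $t^i{}_j$ are linearly independent. -/

import Mathlib

open scoped TensorProduct Kronecker
open Coalgebra (comul counit)
open HopfAlgebra (antipode)

noncomputable section

namespace BraidedLie

/-! ### Quadratic algebras and Koszul duals -/

section Quadratic

variable {k : Type*} [Field k] {V : Type*} [AddCommMonoid V] [Module k V]

/-- The inclusion of `V ⊗ V` as the degree two part of the tensor algebra. -/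
def degTwo : V ⊗[k] V →ₗ[k] TensorAlgebra k V :=
  LinearMap.mul' k (TensorAlgebra k V) ∘ₗ
    TensorProduct.map (TensorAlgebra.ι k) (TensorAlgebra.ι k)

/-- The quadratic algebra `T(V) / ⟨S⟩` with relations a subspace `S` of `V ⊗ V`. -/
abbrev QuadAlg (S : Submodule k (V ⊗[k] V)) : Type _ :=
  RingQuot (fun x y : TensorAlgebra k V => x ∈ S.map degTwo ∧ y = 0)

/-- The generators of a quadratic algebra. -/
def QuadAlg.gen (S : Submodule k (V ⊗[k] V)) : V →ₗ[k] QuadAlg S :=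
  (RingQuot.mkAlgHom k _).toLinearMap ∘ₗ TensorAlgebra.ι k

/-- The orthogonal `S^⊥ ⊆ V* ⊗ V*` of `S ⊆ V ⊗ V` for the pairing
`⟨f ⊗ g, v ⊗ w⟩ = f v * g w`. -/
def perp (S : Submodule k (V ⊗[k] V)) :
    Submodule k (Module.Dual k V ⊗[k] Module.Dual k V) :=
  S.dualAnnihilator.comap (TensorProduct.dualDistrib k V V)

/-- The Koszul dual `T(V*) / ⟨S^⊥⟩` of the quadratic algebra `T(V) / ⟨S⟩`
(for `V` finite-dimensional). -/
abbrev KoszulDual (S : Submodule k (V ⊗[k] V)) : Type _ := QuadAlg (perp S)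

end Quadratic

section Hopf

variable {k : Type*} [Field k] {A : Type*} [Ring A] [HopfAlgebra k A]

/-- `ℛ` is a coquasitriangular structure on the Hopf algebra `A`: it is convolution-invertible,
`b₁ a₁ ℛ(a₂ ⊗ b₂) = ℛ(a₁ ⊗ b₁) a₂ b₂`, `ℛ(ab ⊗ c) = ℛ(a ⊗ c₁) ℛ(b ⊗ c₂)` and
`ℛ(a ⊗ bc) = ℛ(a₁ ⊗ c) ℛ(a₂ ⊗ b)`. -/
structure IsCoquasitriangular (ℛ : A ⊗[k] A →ₗ[k] k) : Prop where
  isUnit : IsUnit (WithConv.toConv ℛ)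
  quasicomm :
    (TensorProduct.rid k A).toLinearMap ∘ₗ
        TensorProduct.map (LinearMap.mul' k A ∘ₗ (TensorProduct.comm k A A).toLinearMap) ℛ ∘ₗ
        comul =
      (TensorProduct.lid k A).toLinearMap ∘ₗ TensorProduct.map ℛ (LinearMap.mul' k A) ∘ₗ comul
  mul_left : ∀ a b c : A, ℛ ((a * b) ⊗ₜ c) =
    LinearMap.mul' k k (TensorProduct.map
      (ℛ ∘ₗ TensorProduct.mk k A A a) (ℛ ∘ₗ TensorProduct.mk k A A b) (comul c))
  mul_right : ∀ a b c : A, ℛ (a ⊗ₜ (b * c)) =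
    LinearMap.mul' k k (TensorProduct.map
      (ℛ ∘ₗ (TensorProduct.mk k A A).flip c) (ℛ ∘ₗ (TensorProduct.mk k A A).flip b) (comul a))

/-- The quantum Killing form `𝒬(a ⊗ b) = ℛ(b₁ ⊗ a₁) ℛ(a₂ ⊗ b₂)`. -/
def quantumKilling (ℛ : A ⊗[k] A →ₗ[k] k) : A ⊗[k] A →ₗ[k] k :=
  LinearMap.mul' k k ∘ₗ
    TensorProduct.map (ℛ ∘ₗ (TensorProduct.comm k A A).toLinearMap) ℛ ∘ₗ comul

/-- `u(a) = ℛ(a₂ ⊗ S a₁)`. -/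
def drinfeldU (ℛ : A ⊗[k] A →ₗ[k] k) : A →ₗ[k] k :=
  ℛ ∘ₗ (antipode k).lTensor A ∘ₗ (TensorProduct.comm k A A).toLinearMap ∘ₗ comul

/-- For right comodules `V`, `W` of `A`, the braiding `Ψ(v ⊗ w) = w₀ ⊗ v₀ ℛ(v₁ ⊗ w₁)`. -/
def comoduleBraiding (ℛ : A ⊗[k] A →ₗ[k] k) {V W : Type*} [AddCommMonoid V] [Module k V]
    [AddCommMonoid W] [Module k W] (ρV : V →ₗ[k] V ⊗[k] A) (ρW : W →ₗ[k] W ⊗[k] A) :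
    V ⊗[k] W →ₗ[k] W ⊗[k] V :=
  (TensorProduct.rid k (W ⊗[k] V)).toLinearMap ∘ₗ
    TensorProduct.map (TensorProduct.comm k V W).toLinearMap ℛ ∘ₗ
    (TensorProduct.tensorTensorTensorComm k V A W A).toLinearMap ∘ₗ
    TensorProduct.map ρV ρW

/-! ### Subcoalgebras -/

/-- A subcoalgebra of `A`: a subspace `L` with `Δ L ⊆ L ⊗ L`. -/
structure Subcoalgebra (k A : Type*) [Field k] [Ring A] [HopfAlgebra k A] where
  carrier : Submodule k A
  comul_mem : ∀ x ∈ carrier,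
    comul x ∈ LinearMap.range (TensorProduct.map carrier.subtype carrier.subtype)

namespace Subcoalgebra

instance : CoeSort (Subcoalgebra k A) (Type _) := ⟨fun L => L.carrier⟩

variable (L : Subcoalgebra k A)

lemma map_subtype_injective :
    Function.Injective (TensorProduct.map L.carrier.subtype L.carrier.subtype) :=
  TensorProduct.map_injective_of_flat_flat _ _ L.carrier.injective_subtype
    L.carrier.injective_subtype

/-- The restricted coproduct. -/
def comulL : L →ₗ[k] L ⊗[k] L :=
  (LinearEquiv.ofInjective _ L.map_subtype_injective).symm.toLinearMap ∘ₗ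
    (comul ∘ₗ L.carrier.subtype).codRestrict
      (LinearMap.range (TensorProduct.map L.carrier.subtype L.carrier.subtype))
      (fun x => L.comul_mem x x.2)

lemma map_comulL (x : L) :
    TensorProduct.map L.carrier.subtype L.carrier.subtype (L.comulL x) = comul (x : A) := by
  have := LinearEquiv.apply_symm_apply (LinearEquiv.ofInjective _ L.map_subtype_injective)
    (((comul ∘ₗ L.carrier.subtype).codRestrict
      (LinearMap.range (TensorProduct.map L.carrier.subtype L.carrier.subtype))
      (fun x => L.comul_mem x x.2)) x)
  exact congrArg Subtype.val this

lemma lcomp_comulL :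
    TensorProduct.map L.carrier.subtype L.carrier.subtype ∘ₗ L.comulL =
      comul ∘ₗ L.carrier.subtype :=
  LinearMap.ext L.map_comulL

instance : Coalgebra k L where
  comul := L.comulL
  counit := counit ∘ₗ L.carrier.subtype
  coassoc := by
    have hinj : Function.Injective (TensorProduct.map L.carrier.subtype
        (TensorProduct.map L.carrier.subtype L.carrier.subtype)) :=
      TensorProduct.map_injective_of_flat_flat _ _ L.carrier.injective_subtype
        L.map_subtype_injective
    have h1 : TensorProduct.map L.carrier.subtype
          (TensorProduct.map L.carrier.subtype L.carrier.subtype) ∘ₗ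
        (TensorProduct.assoc k L L L).toLinearMap =
        (TensorProduct.assoc k A A A).toLinearMap ∘ₗ
          TensorProduct.map (TensorProduct.map L.carrier.subtype L.carrier.subtype)
            L.carrier.subtype := by
      ext; simp
    have h2 : TensorProduct.map L.carrier.subtype
          (TensorProduct.map L.carrier.subtype L.carrier.subtype) ∘ₗ L.comulL.lTensor L =
        (comul (R := k) (A := A)).lTensor A ∘ₗ
          TensorProduct.map L.carrier.subtype L.carrier.subtype := by
      rw [LinearMap.map_comp_lTensor, lcomp_comulL, LinearMap.lTensor_comp_map]
    have h3 : TensorProduct.map (TensorProduct.map L.carrier.subtype L.carrier.subtype)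
          L.carrier.subtype ∘ₗ L.comulL.rTensor L =
        (comul (R := k) (A := A)).rTensor A ∘ₗ
          TensorProduct.map L.carrier.subtype L.carrier.subtype := by
      rw [LinearMap.map_comp_rTensor, lcomp_comulL, LinearMap.rTensor_comp_map]
    refine LinearMap.ext fun x => hinj ?_
    have e1 := LinearMap.congr_fun h1 (L.comulL.rTensor L (L.comulL x))
    have e2 := LinearMap.congr_fun h2 (L.comulL x)
    have e3 := LinearMap.congr_fun h3 (L.comulL x)
    simp only [LinearMap.comp_apply, LinearEquiv.coe_coe, map_comulL] at e1 e2 e3 ⊢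
    rw [e1, e2, e3]
    exact Coalgebra.coassoc_apply (R := k) (x : A)
  rTensor_counit_comp_comul := by
    have hinj : Function.Injective (L.carrier.subtype.lTensor k) :=
      Module.Flat.lTensor_preserves_injective_linearMap _ L.carrier.injective_subtype
    refine (LinearMap.cancel_left hinj).1 ?_
    have h : L.carrier.subtype.lTensor k ∘ₗ (counit ∘ₗ L.carrier.subtype).rTensor L =
        (counit (R := k) (A := A)).rTensor A ∘ₗ
          TensorProduct.map L.carrier.subtype L.carrier.subtype := by
      ext; simp
    rw [← LinearMap.comp_assoc, h, LinearMap.comp_assoc, lcomp_comulL, ← LinearMap.comp_assoc,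
      Coalgebra.rTensor_counit_comp_comul]
    ext; simp
  lTensor_counit_comp_comul := by
    have hinj : Function.Injective (L.carrier.subtype.rTensor k) :=
      Module.Flat.rTensor_preserves_injective_linearMap _ L.carrier.injective_subtype
    refine (LinearMap.cancel_left hinj).1 ?_
    have h : L.carrier.subtype.rTensor k ∘ₗ (counit ∘ₗ L.carrier.subtype).lTensor L =
        (counit (R := k) (A := A)).lTensor A ∘ₗ
          TensorProduct.map L.carrier.subtype L.carrier.subtype := by
      ext; simp
    rw [← LinearMap.comp_assoc, h, LinearMap.comp_assoc, lcomp_comulL, ← LinearMap.comp_assoc,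
      Coalgebra.lTensor_counit_comp_comul]
    ext; simp

/-- The inclusion of a subcoalgebra. -/
def incl : L →ₗc[k] A :=
  { L.carrier.subtype with
    counit_comp := rfl
    map_comp_comul := L.lcomp_comulL }

end Subcoalgebra

/-! ### The braided-Lie algebra of a coalgebra `L` over `A` -/

section BraidedLieAlgebra

variable {L : Type*} [AddCommGroup L] [Module k L] [Coalgebra k L]

/-- `x ↦ x₂ ⊗ (x₁ ⊗ x₃)`. -/
def midSplit : L →ₗ[k] L ⊗[k] (L ⊗[k] L) :=
  (TensorProduct.leftComm k L L L).toLinearMap ∘ₗ (comul (R := k) (A := L)).lTensor L ∘ₗ comul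

/-- The right adjoint coaction `Ad_R(x) = x₂ ⊗ (S x₁) x₃`. -/
def adR (j : L →ₗc[k] A) : L →ₗ[k] L ⊗[k] A :=
  (LinearMap.mul' k A ∘ₗ
    TensorProduct.map (antipode k ∘ₗ j.toLinearMap) j.toLinearMap).lTensor L ∘ₗ midSplit

/-- The braided-Lie bracket `[x, y] = y₀ 𝒬(x ⊗ y₁)`, with `y₀ ⊗ y₁ = Ad_R(y)`. -/
def bracket (ℛ : A ⊗[k] A →ₗ[k] k) (j : L →ₗc[k] A) : L ⊗[k] L →ₗ[k] L :=
  (TensorProduct.rid k L).toLinearMap ∘ₗ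
    (quantumKilling ℛ ∘ₗ j.toLinearMap.rTensor A).lTensor L ∘ₗ
    (TensorProduct.leftComm k L L A).toLinearMap ∘ₗ (adR j).lTensor L

/-- The categorical braiding of `L` in the category of right `A`-comodules under `Ad_R`. -/
def catBraiding (ℛ : A ⊗[k] A →ₗ[k] k) (j : L →ₗc[k] A) : L ⊗[k] L →ₗ[k] L ⊗[k] L :=
  comoduleBraiding ℛ (adR j) (adR j)

/-- The associated braiding `Ψ̃ = ([ , ] ⊗ id)(id ⊗ Ψ)(Δ ⊗ id)` of the braided-Lie algebra. -/
def assocBraiding (ℛ : A ⊗[k] A →ₗ[k] k) (j : L →ₗc[k] A) : L ⊗[k] L →ₗ[k] L ⊗[k] L :=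
  (bracket ℛ j).rTensor L ∘ₗ (TensorProduct.assoc k L L L).symm.toLinearMap ∘ₗ
    (catBraiding ℛ j).lTensor L ∘ₗ (TensorProduct.assoc k L L L).toLinearMap ∘ₗ
    (comul (R := k) (A := L)).rTensor L

/-- The quadratic relations `x y = · Ψ̃(x ⊗ y)` of the braided enveloping algebra. -/
def envRel (ℛ : A ⊗[k] A →ₗ[k] k) (j : L →ₗc[k] A) : Submodule k (L ⊗[k] L) :=
  LinearMap.range (LinearMap.id - assocBraiding ℛ j)

/-- The braided enveloping algebra `U(L)`. -/
abbrev Env (ℛ : A ⊗[k] A →ₗ[k] k) (j : L →ₗc[k] A) : Type _ := QuadAlg (envRel ℛ j)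

/-- The coefficient map `f ↦ (x ↦ f(x₀) x₁)` of the right coaction `Ad_R` on `L`. -/
def coeff (j : L →ₗc[k] A) : Module.Dual k L →ₗ[k] L →ₗ[k] A :=
  LinearMap.mk₂ k (fun f x => TensorProduct.lid k A (f.rTensor A (adR j x)))
    (fun f g x => by simp [LinearMap.rTensor_add]) (fun c f x => by simp [LinearMap.rTensor_smul])
    (fun f x y => by simp) (fun c f x => by simp)

/-! ### The braided-Killing form -/

/-- The right coaction on `L*` (as the right dual of `L` in the category of right
`A`-comodules), determined by `f₀(x) f₁ = f(x₀) S x₁`. -/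
def dualCoaction [FiniteDimensional k L] (j : L →ₗc[k] A) :
    Module.Dual k L →ₗ[k] Module.Dual k L ⊗[k] A :=
  (dualTensorHomEquiv k L A).symm.toLinearMap ∘ₗ
    LinearMap.compRight k (antipode k) ∘ₗ coeff j

/-- The braided-Killing form `K(x, y)`: the braided trace of `[x, [y, ]]`, that is
`ev ∘ Ψ_{L, L*}` applied to `∑ᵢ [x, [y, eᵢ]] ⊗ fⁱ`, with `∑ᵢ eᵢ ⊗ fⁱ` the coevaluation. -/
def braidedKilling [FiniteDimensional k L] (ℛ : A ⊗[k] A →ₗ[k] k) (j : L →ₗc[k] A)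
    (x y : L) : k :=
  contractLeft k L (comoduleBraiding ℛ (adR j) (dualCoaction j)
    (((bracket ℛ j ∘ₗ TensorProduct.mk k L L x) ∘ₗ
      (bracket ℛ j ∘ₗ TensorProduct.mk k L L y)).rTensor (Module.Dual k L)
        (coevaluation k L 1)))

/-- The linear functional `c ↦ u(c₁) 𝒬(a ⊗ c₂) 𝒬(b ⊗ c₃)` on `A`. -/
def killingWeight (ℛ : A ⊗[k] A →ₗ[k] k) (a b : A) : A →ₗ[k] k :=
  LinearMap.mul' k k ∘ₗ TensorProduct.map (drinfeldU ℛ)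
    (LinearMap.mul' k k ∘ₗ
      TensorProduct.map (quantumKilling ℛ ∘ₗ TensorProduct.mk k A A a)
        (quantumKilling ℛ ∘ₗ TensorProduct.mk k A A b) ∘ₗ comul) ∘ₗ comul

/-! ### The right-handed calculus on `L*` and its quadratic exterior algebra

The right crossed module `L` (coaction `Ad_R` and the action below) dualises to a left crossed
module `L*`, the right-handed version of the dual of the left crossed module
`Ad_L(x) = x₁ S x₃ ⊗ x₂`, `a ▷ x = x₂ ℛ(x₁ ⊗ a₁) ℛ(a₂ ⊗ x₃)` (one passes to the opposite product
and coproduct of `A`, for which `ℛ` is again a coquasitriangular structure). -/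

/-- The right action `x ◁ a = x₂ ℛ(a₁ ⊗ x₁) ℛ(x₃ ⊗ a₂)`. -/
def crossedAction (ℛ : A ⊗[k] A →ₗ[k] k) (j : L →ₗc[k] A) : L ⊗[k] A →ₗ[k] L :=
  (TensorProduct.rid k L).toLinearMap ∘ₗ
    (LinearMap.mul' k k ∘ₗ
      TensorProduct.map
        (ℛ ∘ₗ (TensorProduct.comm k A A).toLinearMap ∘ₗ j.toLinearMap.rTensor A)
        (ℛ ∘ₗ j.toLinearMap.rTensor A) ∘ₗ
      (TensorProduct.tensorTensorTensorComm k L L A A).toLinearMap).lTensor L ∘ₗ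
    (TensorProduct.assoc k L (L ⊗[k] L) (A ⊗[k] A)).toLinearMap ∘ₗ
    TensorProduct.map midSplit comul

/-- The dual left action `(a ▷ f)(x) = f(x ◁ a)` of `A` on `L*`. -/
def dualAction (ℛ : A ⊗[k] A →ₗ[k] k) (j : L →ₗc[k] A) :
    A →ₗ[k] Module.Dual k L →ₗ[k] Module.Dual k L :=
  Module.Dual.transpose ∘ₗ (TensorProduct.mk k L A).flip.compr₂ (crossedAction ℛ j)

/-- The dual left coaction of `A` on `L*`, determined by `f₋₁ f₀(x) = f(x₀) x₁`. -/
def dualLeftCoaction [FiniteDimensional k L] (j : L →ₗc[k] A) :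
    Module.Dual k L →ₗ[k] A ⊗[k] Module.Dual k L :=
  (TensorProduct.comm k (Module.Dual k L) A).toLinearMap ∘ₗ
    (dualTensorHomEquiv k L A).symm.toLinearMap ∘ₗ coeff j

/-- The left crossed-module braiding `Ψ(f ⊗ g) = f₋₁ ▷ g ⊗ f₀` on `L*`. -/
def dualBraiding [FiniteDimensional k L] (ℛ : A ⊗[k] A →ₗ[k] k) (j : L →ₗc[k] A) :
    Module.Dual k L ⊗[k] Module.Dual k L →ₗ[k] Module.Dual k L ⊗[k] Module.Dual k L :=
  (TensorProduct.lift (dualAction ℛ j)).rTensor (Module.Dual k L) ∘ₗ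
    (TensorProduct.assoc k A (Module.Dual k L) (Module.Dual k L)).symm.toLinearMap ∘ₗ
    (TensorProduct.comm k (Module.Dual k L) (Module.Dual k L)).toLinearMap.lTensor A ∘ₗ
    (TensorProduct.assoc k A (Module.Dual k L) (Module.Dual k L)).toLinearMap ∘ₗ
    (dualLeftCoaction j).rTensor (Module.Dual k L)

/-- The invariant one-forms `Λ¹ = ϖ(A⁺) ⊆ L*` of the calculus, where `A⁺ = ker ε` and `ϖ` is
the (right-handed) quantum Killing map `ϖ(a) = 𝒬(· ⊗ a)`. -/
def oneForms (ℛ : A ⊗[k] A →ₗ[k] k) (j : L →ₗc[k] A) : Submodule k (Module.Dual k L) :=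
  (LinearMap.ker (counit (R := k) (A := A))).map
    ((TensorProduct.mk k L A).flip.compr₂ (quantumKilling ℛ ∘ₗ j.toLinearMap.rTensor A))

/-- The quadratic relations `ker (id - Ψ)` on all of `L*`: the degree two relations of the
braided exterior algebra `B₋(L*)`. -/
def extRel [FiniteDimensional k L] (ℛ : A ⊗[k] A →ₗ[k] k) (j : L →ₗc[k] A) :
    Submodule k (Module.Dual k L ⊗[k] Module.Dual k L) :=
  LinearMap.eqLocus (dualBraiding ℛ j) LinearMap.id

/-- The quadratic relations `ker (id - Ψ) ∩ (W ⊗ W)` of the quadratic exterior algebra on a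
subspace `W` of `L*`. -/
def extRelOn [FiniteDimensional k L] (ℛ : A ⊗[k] A →ₗ[k] k) (j : L →ₗc[k] A)
    (W : Submodule k (Module.Dual k L)) : Submodule k (W ⊗[k] W) :=
  (extRel ℛ j).comap (TensorProduct.map W.subtype W.subtype)

end BraidedLieAlgebra

/-! ### Matrix corepresentations and braided matrices -/

section MatrixCorep

variable {n : ℕ}

/-- `t ∈ M_n(A)` is a matrix corepresentation: `Δ tⁱⱼ = ∑ₐ tⁱₐ ⊗ tᵃⱼ`, `ε tⁱⱼ = δⁱⱼ`. -/
structure IsMatrixCorep (k : Type*) [Field k] {A : Type*} [Ring A] [HopfAlgebra k A] {n : ℕ}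
    (t : Matrix (Fin n) (Fin n) A) : Prop where
  comul_eq : ∀ i j, comul (R := k) (t i j) = ∑ a, t i a ⊗ₜ[k] t a j
  counit_eq : ∀ i j, counit (R := k) (t i j) = (1 : Matrix (Fin n) (Fin n) k) i j

/-- The matrix subcoalgebra spanned by the entries `tⁱⱼ`. -/
def matrixSubcoalgebra (t : Matrix (Fin n) (Fin n) A) (ht : IsMatrixCorep k t) :
    Subcoalgebra k A where
  carrier := Submodule.span k (Set.range fun p : Fin n × Fin n => t p.1 p.2)
  comul_mem := by
    intro x hx
    induction hx using Submodule.span_induction with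
    | mem x h =>
      obtain ⟨p, rfl⟩ := h
      rw [ht.comul_eq]
      refine Submodule.sum_mem _ fun a _ => ?_
      exact ⟨⟨t p.1 a, Submodule.subset_span ⟨(p.1, a), rfl⟩⟩ ⊗ₜ
        ⟨t a p.2, Submodule.subset_span ⟨(a, p.2), rfl⟩⟩, by simp⟩
    | zero => simp
    | add x y _ _ hx hy => rw [map_add]; exact Submodule.add_mem _ hx hy
    | smul c x _ hx => rw [map_smul]; exact Submodule.smul_mem _ c hx

/-- The entry `tⁱⱼ` as an element of the matrix subcoalgebra. -/
def entry (t : Matrix (Fin n) (Fin n) A) (ht : IsMatrixCorep k t) (i j : Fin n) :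
    matrixSubcoalgebra t ht :=
  ⟨t i j, Submodule.subset_span ⟨(i, j), rfl⟩⟩

/-- The R-matrix `Rⁱⱼᵏₗ = ℛ(tⁱⱼ ⊗ tᵏₗ)`, as an element of `M_n ⊗ M_n`: the entry in row `(i, k)`
and column `(j, l)` is `Rⁱⱼᵏₗ`. -/
def rMatrix (ℛ : A ⊗[k] A →ₗ[k] k) (t : Matrix (Fin n) (Fin n) A) :
    Matrix (Fin n × Fin n) (Fin n × Fin n) k :=
  Matrix.of fun p q => ℛ (t p.1 q.1 ⊗ₜ t p.2 q.2)

/-- The second inverse `R̃ⁱⱼᵏₗ = ℛ(tⁱⱼ ⊗ S tᵏₗ)`, with the same indexing. -/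
def rTilde (ℛ : A ⊗[k] A →ₗ[k] k) (t : Matrix (Fin n) (Fin n) A) :
    Matrix (Fin n × Fin n) (Fin n × Fin n) k :=
  Matrix.of fun p q => ℛ (t p.1 q.1 ⊗ₜ antipode k (t p.2 q.2))

/-- For a matrix `u` over a `k`-algebra `B` and `R ∈ M_n ⊗ M_n`, the matrix `R₂₁ u₁ R u₂`. -/
def reflLeft {B : Type*} [Ring B] [Algebra k B] (R : Matrix (Fin n × Fin n) (Fin n × Fin n) k)
    (u : Matrix (Fin n) (Fin n) B) : Matrix (Fin n × Fin n) (Fin n × Fin n) B :=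
  (R.submatrix Prod.swap Prod.swap).map (algebraMap k B) *
    (u ⊗ₖ (1 : Matrix (Fin n) (Fin n) B)) * R.map (algebraMap k B) *
    ((1 : Matrix (Fin n) (Fin n) B) ⊗ₖ u)

/-- For a matrix `u` over a `k`-algebra `B` and `R ∈ M_n ⊗ M_n`, the matrix `u₂ R₂₁ u₁ R`. -/
def reflRight {B : Type*} [Ring B] [Algebra k B] (R : Matrix (Fin n × Fin n) (Fin n × Fin n) k)
    (u : Matrix (Fin n) (Fin n) B) : Matrix (Fin n × Fin n) (Fin n × Fin n) B :=
  ((1 : Matrix (Fin n) (Fin n) B) ⊗ₖ u) *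
    (R.submatrix Prod.swap Prod.swap).map (algebraMap k B) *
    (u ⊗ₖ (1 : Matrix (Fin n) (Fin n) B)) * R.map (algebraMap k B)

/-- The matrix of free generators. -/
def freeGen (k : Type*) [Field k] (n : ℕ) :
    Matrix (Fin n) (Fin n) (FreeAlgebra k (Fin n × Fin n)) :=
  Matrix.of fun i j => FreeAlgebra.ι k (i, j)

/-- The algebra `B(R)` of braided matrices: generators `uⁱⱼ` and relations
`R₂₁ u₁ R u₂ = u₂ R₂₁ u₁ R`. -/
abbrev BraidedMatrices (R : Matrix (Fin n × Fin n) (Fin n × Fin n) k) : Type _ :=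
  RingQuot (fun x y : FreeAlgebra k (Fin n × Fin n) =>
    ∃ p q, x = reflLeft R (freeGen k n) p q ∧ y = reflRight R (freeGen k n) p q)

/-- The generators `uⁱⱼ` of `B(R)`. -/
def BraidedMatrices.gen (R : Matrix (Fin n × Fin n) (Fin n × Fin n) k) (i j : Fin n) :
    BraidedMatrices R :=
  RingQuot.mkAlgHom k _ (freeGen k n i j)

/-- The element `∑ᵢⱼ cᵢⱼ uⁱⱼ` for each linear relation `∑ᵢⱼ cᵢⱼ tⁱⱼ = 0` among the entries
of `t`; there are only trivial ones when the entries are linearly independent. -/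
def linRel {B : Type*} [Ring B] [Algebra k B] (t : Matrix (Fin n) (Fin n) A)
    (u : Matrix (Fin n) (Fin n) B) : Set B :=
  {x | ∃ c : Fin n → Fin n → k, ∑ i, ∑ j, c i j • t i j = 0 ∧ x = ∑ i, ∑ j, c i j • u i j}

/-- The right hand side of the exchange relations,
`uᵏ²ₖ₃ uⁱ²ᵢ₃ R⁻¹ᵏ¹ₖ₂ⁱᵢ₁ Rᵏ³ₖ₄ⁱ¹ᵢ₂ Rⁱ³ᵢ₄ᵏ⁴ₗ R̃ⁱ⁴ⱼᵏₖ₁` (summed over repeated indices). -/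
def exchange (ℛ : A ⊗[k] A →ₗ[k] k) (t : Matrix (Fin n) (Fin n) A)
    {B : Type*} [Ring B] [Algebra k B] (u : Matrix (Fin n) (Fin n) B) (i j m l : Fin n) : B :=
  ∑ k₁, ∑ k₂, ∑ k₃, ∑ k₄, ∑ i₁, ∑ i₂, ∑ i₃, ∑ i₄,
    ((rMatrix ℛ t)⁻¹ (k₁, i) (k₂, i₁) * rMatrix ℛ t (k₃, i₁) (k₄, i₂) *
      rMatrix ℛ t (i₃, k₄) (i₄, l) * rTilde ℛ t (i₄, m) (j, k₁)) • (u k₂ k₃ * u i₂ i₃)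

end MatrixCorep
end Hopf
end BraidedLie

end

open BraidedLie

/-! Both parts rest on two tools. The first is a matrix `T` that spans the coalgebra and satisfies
ΔT = T ⊗ T, ε(T) = 1 (`IsComatrix`). Every finite-dimensional coalgebra has one, namely the
coefficients of its regular comodule, and its entries need not be linearly independent; all
structure maps become finite sums over its indices. The second is that a ↦ ℛ(a ⊗ ·) and a ↦ ℛ(· ⊗ a)
are respectively multiplicative and anti-multiplicative into the convolution algebra of functionals
on `A`.

The central computation is `assocBraiding_apply`. Since 𝒬(x ⊗ ·) = ℛ(· ⊗ x₁) * ℛ(x₂ ⊗ ·), the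
antipode coming from the categorical braiding cancels against the bracket, and Ψ̃(x ⊗ y) = y₀ ⊗ (x ◁
y₁), where y₀ ⊗ y₁ = Ad_R(y). This is the crossed-module braiding of `L`, and its transpose is the
braiding on the dual (`dualDistrib_dualBraiding`). The annihilator of the image of id − Ψ̃ is the
fixed space of the transpose, which gives one Koszul duality; the other is the double annihilator in
finite dimension. For a subspace `W` of the dual, the orthogonal of the relations restricted to `W`
is the image of the original relations under L → W* (`perp_comap_perp`), and pushing relations
forward along a surjection divides the quadratic algebra by the ideal of the kernel
(`QuadAlg.exists_map`).

For the braided-Killing form, ev Ψ(v ⊗ f) = f(v₀) u(v₁), and since Ad_R is a coaction, each bracket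
[x, ·] multiplies the weight on the right by 𝒬(x ⊗ ·) in the convolution algebra.

For a matrix corepresentation the same weights expand into R, R⁻¹ and R̃. The exchange relations are
the reflection equation solved for the product of two generators: R⁻¹ removes the outer R₂₁ and R̃
removes the R between the two generators, both reversibly (`reflLeft_eq_reflRight_iff`). Kernels are
found from universal properties, by factoring the quotient map through the given algebra map
(`ker_eq_span`). -/

noncomputable section

namespace BraidedLie

/-! ### Kernels of algebra maps -/

section Quotients

variable {k : Type*} [Field k] {B C : Type*} [Ring B] [Ring C] [Algebra k B] [Algebra k C]

/-- The quotient map of `B` by a two-sided ideal, as an algebra map. -/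
def quotMk (k : Type*) [Field k] {B : Type*} [Ring B] [Algebra k B] (J : TwoSidedIdeal B) :
    B →ₐ[k] J.ringCon.Quotient :=
  J.ringCon.mkₐ k

lemma quotMk_eq_zero (J : TwoSidedIdeal B) {x : B} : quotMk k J x = 0 ↔ x ∈ J := by
  have : quotMk k J x = J.ringCon.mk' x := rfl
  rw [this, ← TwoSidedIdeal.mem_ker, TwoSidedIdeal.ker_ringCon_mk']

/-- The kernel of `φ` is `J` as soon as `φ` kills `J` and the quotient by `J` factors
through `φ`. -/
lemma ker_eq_span (φ : B →ₐ[k] C) (s : Set B) (hs : ∀ x ∈ s, φ x = 0)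
    (ψ : C →ₐ[k] (TwoSidedIdeal.span s).ringCon.Quotient)
    (h : ψ.comp φ = quotMk k (TwoSidedIdeal.span s)) :
    TwoSidedIdeal.ker φ = TwoSidedIdeal.span s := by
  refine le_antisymm (fun x hx => ?_) (TwoSidedIdeal.span_le.2 fun x hx =>
    (TwoSidedIdeal.mem_ker _).2 (hs x hx))
  rw [← quotMk_eq_zero (k := k), ← h, AlgHom.comp_apply, (TwoSidedIdeal.mem_ker _).1 hx, map_zero]

lemma injective_of_ker_eq_span (φ : B →ₐ[k] C) (s : Set B)
    (h : TwoSidedIdeal.ker φ = TwoSidedIdeal.span s) (hs : ∀ x ∈ s, x = 0) :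
    Function.Injective φ := by
  rw [← TwoSidedIdeal.ker_eq_bot, h, eq_bot_iff, TwoSidedIdeal.span_le]
  exact fun x hx => (TwoSidedIdeal.mem_bot _).2 (hs x hx)

end Quotients

/-! ### Quadratic algebras and their universal property -/

section Quadratic

variable {k : Type*} [Field k] {V V' : Type*} [AddCommMonoid V] [Module k V]
  [AddCommMonoid V'] [Module k V'] {C : Type*} [Ring C] [Algebra k C]

@[simp]
lemma degTwo_tmul (x y : V) :
    degTwo (k := k) (x ⊗ₜ y) = TensorAlgebra.ι k x * TensorAlgebra.ι k y := rfl

lemma lift_degTwo (f : V →ₗ[k] C) (z : V ⊗[k] V) :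
    TensorAlgebra.lift k f (degTwo z) = LinearMap.mul' k C (TensorProduct.map f f z) := by
  have : (TensorAlgebra.lift k f).toLinearMap ∘ₗ degTwo =
      LinearMap.mul' k C ∘ₗ TensorProduct.map f f := by
    ext; simp
  exact LinearMap.congr_fun this z

namespace QuadAlg

variable (S : Submodule k (V ⊗[k] V))

lemma mul_gen_eq_zero {z : V ⊗[k] V} (hz : z ∈ S) :
    LinearMap.mul' k (QuadAlg S) (TensorProduct.map (gen S) (gen S) z) = 0 := by
  have h := RingQuot.mkAlgHom_rel k
    (s := fun x y : TensorAlgebra k V => x ∈ S.map degTwo ∧ y = 0)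
    (x := degTwo z) (y := 0) ⟨Submodule.mem_map_of_mem hz, rfl⟩
  have e : (RingQuot.mkAlgHom k
      (fun x y : TensorAlgebra k V => x ∈ S.map degTwo ∧ y = 0)).toLinearMap ∘ₗ degTwo =
      LinearMap.mul' k (QuadAlg S) ∘ₗ TensorProduct.map (gen S) (gen S) := by
    ext; simp [gen]
  have e' := LinearMap.congr_fun e z
  simp only [LinearMap.comp_apply, AlgHom.toLinearMap_apply] at e'
  rw [← e', h, map_zero]

/-- The universal property of a quadratic algebra. -/
def lift (f : V →ₗ[k] C)
    (hf : ∀ z ∈ S, LinearMap.mul' k C (TensorProduct.map f f z) = 0) : QuadAlg S →ₐ[k] C :=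
  RingQuot.liftAlgHom k ⟨TensorAlgebra.lift k f, by
    rintro _ _ ⟨⟨z, hz, rfl⟩, rfl⟩
    rw [lift_degTwo, hf z hz, map_zero]⟩

@[simp]
lemma lift_gen (f : V →ₗ[k] C)
    (hf : ∀ z ∈ S, LinearMap.mul' k C (TensorProduct.map f f z) = 0) (x : V) :
    lift S f hf (gen S x) = f x := by
  simp [lift, gen, RingQuot.liftAlgHom_mkAlgHom_apply]

variable {S}

lemma algHom_ext {f g : QuadAlg S →ₐ[k] C} (h : ∀ x, f (gen S x) = g (gen S x)) : f = g := by
  apply RingQuot.ringQuot_ext'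
  apply TensorAlgebra.hom_ext
  ext x
  exact h x

lemma surjective_of_range (f : C →ₐ[k] QuadAlg S) (h : ∀ x, ∃ c, f c = gen S x) :
    Function.Surjective f := by
  rw [← AlgHom.range_eq_top, eq_top_iff]
  choose c hc using h
  have hle : TensorAlgebra.lift k (gen S) = RingQuot.mkAlgHom k _ := by
    apply TensorAlgebra.hom_ext
    ext x
    simp [gen]
  have hmem : ∀ x : TensorAlgebra k V, RingQuot.mkAlgHom k _ x ∈ f.range := by
    intro x
    induction x using TensorAlgebra.induction with
    | algebraMap r => rw [AlgHom.commutes]; exact f.range.algebraMap_mem r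
    | ι x => exact ⟨c x, hc x⟩
    | mul a b ha hb => rw [map_mul]; exact f.range.mul_mem ha hb
    | add a b ha hb => rw [map_add]; exact f.range.add_mem ha hb
  intro x _
  obtain ⟨y, rfl⟩ := RingQuot.mkAlgHom_surjective k _ x
  exact hmem y

/-- A surjection `p : V → V'` carrying `S` onto `S'` induces a surjection of quadratic algebras,
with kernel generated by the kernel of `p`. -/
lemma exists_map {V : Type*} [AddCommGroup V] [Module k V] {S : Submodule k (V ⊗[k] V)}
    (p : V →ₗ[k] V') (hp : Function.Surjective p)
    (S' : Submodule k (V' ⊗[k] V')) (hS : S' = S.map (TensorProduct.map p p)) :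
    ∃ π : QuadAlg S →ₐ[k] QuadAlg S', (∀ x, π (gen S x) = gen S' (p x)) ∧
      Function.Surjective π ∧
      TwoSidedIdeal.ker π = TwoSidedIdeal.span (gen S '' {x | p x = 0}) := by
  have hmap (z : V ⊗[k] V) : TensorProduct.map (gen S' ∘ₗ p) (gen S' ∘ₗ p) z =
      TensorProduct.map (gen S') (gen S') (TensorProduct.map p p z) := by
    rw [TensorProduct.map_comp, LinearMap.comp_apply]
  let π : QuadAlg S →ₐ[k] QuadAlg S' := lift S (gen S' ∘ₗ p) fun z hz => by
    rw [hmap]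
    exact mul_gen_eq_zero S' (hS ▸ Submodule.mem_map_of_mem hz)
  have hπ (x : V) : π (gen S x) = gen S' (p x) := lift_gen _ _ _ _
  refine ⟨π, hπ, surjective_of_range π fun x => ?_, ?_⟩
  · obtain ⟨v, rfl⟩ := hp x
    exact ⟨gen S v, hπ v⟩
  let _ : AddCommGroup V' := Module.addCommMonoidToAddCommGroup k
  -- A linear section of `p` suffices for the inverse map: s (p x) − x lies in the kernel of `p`, so
  -- modulo the ideal the generators of s (p x) and of x agree.
  obtain ⟨s, hs⟩ := p.exists_rightInverse_of_surjective (LinearMap.range_eq_top.2 hp)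
  have hs' (x : V') : p (s x) = x := LinearMap.congr_fun hs x
  let J := TwoSidedIdeal.span (gen S '' {x | p x = 0})
  have hJ (x : V) : quotMk k J (gen S (s (p x))) = quotMk k J (gen S x) := by
    rw [← sub_eq_zero, ← map_sub, quotMk_eq_zero, ← map_sub]
    exact TwoSidedIdeal.subset_span ⟨_, by simp [hs'], rfl⟩
  let q : V' →ₗ[k] J.ringCon.Quotient := (quotMk k J).toLinearMap ∘ₗ gen S ∘ₗ s
  have hq : q ∘ₗ p = (quotMk k J).toLinearMap ∘ₗ gen S := LinearMap.ext hJ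
  have hq0 (z : V' ⊗[k] V') (hz : z ∈ S') :
      LinearMap.mul' k J.ringCon.Quotient (TensorProduct.map q q z) = 0 := by
    subst hS
    obtain ⟨z, hz, rfl⟩ := hz
    rw [← LinearMap.comp_apply (TensorProduct.map q q), ← TensorProduct.map_comp, hq]
    have e : LinearMap.mul' k J.ringCon.Quotient ∘ₗ TensorProduct.map
        ((quotMk k J).toLinearMap ∘ₗ gen S) ((quotMk k J).toLinearMap ∘ₗ gen S) =
        (quotMk k J).toLinearMap ∘ₗ LinearMap.mul' k _ ∘ₗ TensorProduct.map (gen S) (gen S) := by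
      ext; simp
    have e' := LinearMap.congr_fun e z
    simp only [LinearMap.comp_apply, mul_gen_eq_zero S hz, map_zero] at e'
    exact e'
  refine ker_eq_span π _ ?_ (lift S' q hq0) (algHom_ext fun x => ?_)
  · rintro _ ⟨x, hx, rfl⟩
    rw [hπ, show p x = 0 from hx, map_zero]
  · rw [AlgHom.comp_apply, hπ, lift_gen]
    exact hJ x

lemma exists_equiv_of_eq (S' : Submodule k (V ⊗[k] V)) (h : S = S') :
    ∃ e : QuadAlg S ≃ₐ[k] QuadAlg S', ∀ x, e (gen S x) = gen S' x := by
  subst h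
  exact ⟨AlgEquiv.refl, fun _ => rfl⟩

end QuadAlg

/-! ### Orthogonal relations and Koszul duals -/

section Duality

variable {V : Type*} [AddCommGroup V] [Module k V] [FiniteDimensional k V]
  {W : Type*} [AddCommMonoid W] [Module k W] [Module.Finite k W]

lemma dualDistrib_injective (k V W : Type*) [Field k] [AddCommGroup V] [Module k V]
    [AddCommGroup W] [Module k W] [FiniteDimensional k V] [FiniteDimensional k W] :
    Function.Injective (TensorProduct.dualDistrib k V W) :=
  (TensorProduct.dualDistribEquiv k V W).injective

/-- The orthogonal of the restriction of `S^⊥` along `i : W → V*` is the image of `S` under the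
transpose `V → W*` of `i`. -/
lemma perp_comap_perp (S : Submodule k (V ⊗[k] V)) (i : W →ₗ[k] Module.Dual k V) :
    perp ((perp S).comap (TensorProduct.map i i)) = S.map (TensorProduct.map i.flip i.flip) := by
  let _ : AddCommGroup W := Module.addCommMonoidToAddCommGroup k
  have hD (w : W ⊗[k] W) (z : V ⊗[k] V) :
      TensorProduct.dualDistrib k W W (TensorProduct.map i.flip i.flip z) w =
        TensorProduct.dualDistrib k V V (TensorProduct.map i i w) z := by
    induction w with
    | zero => simp
    | add a b ha hb => simp [ha, hb]
    | tmul a b =>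
      induction z with
      | zero => simp
      | add c d hc hd =>
        simp only [map_add, LinearMap.add_apply, hc, hd]
      | tmul c d => simp
  set P := S.map (TensorProduct.map i.flip i.flip) with hP
  refine le_antisymm (fun z hz => ?_) ?_
  -- Double annihilator: seen as a functional on W ⊗ W, `z` vanishes on everything annihilated by
  -- `P`. In finite dimension a space of functionals is the annihilator of its coannihilator, so `z`
  -- lies in `P`.
  · have hle : (P.map (TensorProduct.dualDistrib k W W)).dualCoannihilator ≤
        (perp S).comap (TensorProduct.map i i) := by
      intro w hw
      rw [Submodule.mem_comap, perp, Submodule.mem_comap, Submodule.mem_dualAnnihilator]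
      intro s hs
      rw [← hD]
      exact (Submodule.mem_dualCoannihilator _).1 hw _
        (Submodule.mem_map_of_mem (Submodule.mem_map_of_mem hs))
    have h1 := Submodule.dualAnnihilator_anti hle (Submodule.mem_comap.1 hz)
    rw [Subspace.dualCoannihilator_dualAnnihilator_eq] at h1
    obtain ⟨y, hy, hyz⟩ := h1
    rwa [← dualDistrib_injective k W W hyz]
  · rintro _ ⟨s, hs, rfl⟩
    rw [perp, Submodule.mem_comap, Submodule.mem_dualAnnihilator]
    intro w hw
    rw [hD]
    exact (Submodule.mem_dualAnnihilator _).1 (Submodule.mem_comap.1 hw) s hs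

lemma perp_perp (S : Submodule k (V ⊗[k] V)) :
    perp (perp S) = S.map (TensorProduct.map (Module.Dual.eval k V) (Module.Dual.eval k V)) := by
  simpa [Module.Dual.eval] using! perp_comap_perp S (LinearMap.id (M := Module.Dual k V))

/-- The orthogonal of the image of `id - Φ` is the fixed space of the transpose of `Φ`. -/
lemma perp_range_id_sub (Φ : V ⊗[k] V →ₗ[k] V ⊗[k] V)
    (Φ' : Module.Dual k V ⊗[k] Module.Dual k V →ₗ[k] Module.Dual k V ⊗[k] Module.Dual k V)
    (h : ∀ w z, TensorProduct.dualDistrib k V V (Φ' w) z =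
      TensorProduct.dualDistrib k V V w (Φ z)) :
    perp (LinearMap.range (LinearMap.id - Φ)) = LinearMap.eqLocus Φ' LinearMap.id := by
  ext w
  rw [perp, Submodule.mem_comap, Submodule.mem_dualAnnihilator, LinearMap.mem_eqLocus,
    LinearMap.id_apply, ← (dualDistrib_injective k V V).eq_iff, LinearMap.ext_iff]
  simp only [h, LinearMap.mem_range, forall_exists_index, forall_apply_eq_imp_iff,
    LinearMap.sub_apply, LinearMap.id_apply, map_sub, sub_eq_zero]
  exact forall_congr' fun z => eq_comm

-- The flip is the transpose of `i` composed with V ≅ V**. Transposing an injection over a field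
-- gives a surjection.
omit [Module.Finite k W] in
lemma flip_surjective_of_injective (i : W →ₗ[k] Module.Dual k V) (hi : Function.Injective i) :
    Function.Surjective i.flip := by
  let _ : AddCommGroup W := Module.addCommMonoidToAddCommGroup k
  have : i.flip = i.dualMap ∘ₗ Module.Dual.eval k V := by ext; rfl
  rw [this, LinearMap.coe_comp]
  exact (LinearMap.dualMap_surjective_of_injective hi).comp
    (Module.evalEquiv k V).surjective

/-- A quadratic algebra is the Koszul dual of its Koszul dual. -/
lemma exists_equiv_koszulDual_perp (S : Submodule k (V ⊗[k] V)) :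
    ∃ e : QuadAlg S ≃ₐ[k] KoszulDual (perp S),
      ∀ x, e (QuadAlg.gen S x) = QuadAlg.gen (perp (perp S)) (Module.Dual.eval k V x) := by
  obtain ⟨π, hπ, hsurj, hker⟩ := QuadAlg.exists_map (S := S)
    (Module.Dual.eval k V) (Module.evalEquiv k V).surjective (perp (perp S)) (perp_perp S)
  refine ⟨AlgEquiv.ofBijective π ⟨injective_of_ker_eq_span π _ hker ?_, hsurj⟩, hπ⟩
  rintro _ ⟨x, hx, rfl⟩
  rw [(Module.evalEquiv k V).injective (hx.trans (map_zero _).symm), map_zero]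

/-- Restricting the Koszul dual relations to a subspace `W` of `V*` gives a quotient, by the
annihilator of `W`, of the quadratic algebra on `V`. -/
lemma exists_koszulDual_comap (S : Submodule k (V ⊗[k] V)) (W : Submodule k (Module.Dual k V)) :
    ∃ π : QuadAlg S →ₐ[k] KoszulDual ((perp S).comap (TensorProduct.map W.subtype W.subtype)),
      (∀ x, π (QuadAlg.gen S x) =
        QuadAlg.gen (perp ((perp S).comap (TensorProduct.map W.subtype W.subtype)))
          (Module.Dual.eval k V x ∘ₗ W.subtype)) ∧
      Function.Surjective π ∧
      TwoSidedIdeal.ker π = TwoSidedIdeal.span (QuadAlg.gen S '' {x | ∀ f ∈ W, f x = 0}) ∧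
      (W = ⊤ → Function.Bijective π) := by
  let i : W →ₗ[k] Module.Dual k V := W.subtype
  obtain ⟨π, hπ, hsurj, hker⟩ := QuadAlg.exists_map (S := S) i.flip
    (flip_surjective_of_injective i W.injective_subtype) _ (perp_comap_perp S i)
  have hset : {x : V | i.flip x = 0} = {x : V | ∀ f ∈ W, f x = 0} := by
    ext x
    simp [LinearMap.ext_iff, i]
  rw [hset] at hker
  refine ⟨π, hπ, hsurj, hker, fun htop => ⟨injective_of_ker_eq_span π _ hker ?_, hsurj⟩⟩
  rintro _ ⟨x, hx, rfl⟩
  rw [(Module.forall_dual_apply_eq_zero_iff k x).1 fun f => hx f (htop ▸ Submodule.mem_top),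
    map_zero]

end Duality
end Quadratic

/-! ### Comatrix bases -/

section Comatrix

variable {k : Type*} [Field k] {L : Type*} [AddCommGroup L] [Module k L] [Coalgebra k L]

/-- The entries of `T` span the coalgebra `L` and obey the comultiplication rules of a matrix
coalgebra; linear independence is not required. -/
structure IsComatrix (k : Type*) [Field k] {L : Type*} [AddCommGroup L] [Module k L]
    [Coalgebra k L] {n : ℕ} (T : Matrix (Fin n) (Fin n) L) : Prop where
  comul_eq : ∀ i j, comul (R := k) (T i j) = ∑ a, T i a ⊗ₜ[k] T a j
  counit_eq : ∀ i j, counit (R := k) (T i j) = (1 : Matrix (Fin n) (Fin n) k) i j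
  span_eq : Submodule.span k (Set.range fun p : Fin n × Fin n => T p.1 p.2) = ⊤

namespace IsComatrix

variable {n : ℕ} {T : Matrix (Fin n) (Fin n) L} (hT : IsComatrix k T)

-- Spanning alone determines a linear map, so identities may be checked on entries even when these
-- are linearly dependent.
include hT in
lemma hom_ext {M : Type*} [AddCommMonoid M] [Module k M] {f g : L →ₗ[k] M}
    (h : ∀ i j, f (T i j) = g (T i j)) : f = g :=
  LinearMap.ext_on_range hT.span_eq fun p => h p.1 p.2

include hT in
lemma hom_ext₂ {M : Type*} [AddCommMonoid M] [Module k M] {f g : L ⊗[k] L →ₗ[k] M}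
    (h : ∀ i j m l, f (T i j ⊗ₜ T m l) = g (T i j ⊗ₜ T m l)) : f = g := by
  apply TensorProduct.ext
  refine hT.hom_ext fun i j => hT.hom_ext fun m l => ?_
  simpa using h i j m l

/-- Every finite-dimensional coalgebra is spanned by the entries of a matrix of coefficients. -/
lemma exists_of_finiteDimensional [FiniteDimensional k L] :
    ∃ T : Matrix (Fin (Module.finrank k L)) (Fin (Module.finrank k L)) L, IsComatrix k T := by
  let b := Module.finBasis k L
  let T : Matrix (Fin (Module.finrank k L)) (Fin (Module.finrank k L)) L :=
    Matrix.of fun i j => TensorProduct.lid k L ((b.coord i).rTensor L (comul (b j)))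
  -- `T` consists of the coefficients of the regular comodule in the basis `b`. Comparing
  -- coefficients of `b i` in coassociativity gives ΔT = T ⊗ T.
  have hb (j) : comul (R := k) (b j) = ∑ i, b i ⊗ₜ[k] T i j := by
    have h (z : L ⊗[k] L) :
        z = ∑ i, b i ⊗ₜ[k] TensorProduct.lid k L ((b.coord i).rTensor L z) := by
      induction z with
      | zero => simp
      | tmul x y =>
        simp only [LinearMap.rTensor_tmul, TensorProduct.lid_tmul, ← TensorProduct.smul_tmul,
          ← TensorProduct.sum_tmul, Module.Basis.coord_apply]
        rw [b.sum_repr]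
      | add x y hx hy =>
        conv_lhs => rw [hx, hy]
        simp [TensorProduct.tmul_add, Finset.sum_add_distrib]
    exact h _
  refine ⟨T, fun i j => ?_, fun i j => ?_, ?_⟩
  · have h := Coalgebra.coassoc_apply (R := k) (b j)
    rw [hb] at h
    simp only [map_sum, LinearMap.rTensor_tmul, LinearMap.lTensor_tmul, hb,
      TensorProduct.sum_tmul, TensorProduct.assoc_tmul] at h
    have h' := congrArg (TensorProduct.lid k (L ⊗[k] L) ∘ (b.coord i).rTensor (L ⊗[k] L)) h
    simp only [Function.comp_apply, map_sum, LinearMap.rTensor_tmul, TensorProduct.lid_tmul,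
      Module.Basis.coord_apply, Module.Basis.repr_self, Finsupp.single_apply, ite_smul, one_smul,
      zero_smul, Finset.sum_ite_eq', Finset.mem_univ, if_true] at h'
    rw [← h']
  · have h := Coalgebra.lTensor_counit_comul (R := k) (b j)
    rw [hb] at h
    have h' := congrArg (b.coord i ∘ TensorProduct.rid k L) h
    simpa [Finsupp.single_apply, Matrix.one_apply, eq_comm] using h'
  · rw [eq_top_iff, ← b.span_eq, Submodule.span_le]
    rintro _ ⟨j, rfl⟩
    -- The counit on the first factor gives b j = ∑ᵢ ε(b i) T i j, so the entries span.
    have h := congrArg (TensorProduct.lid k L) (Coalgebra.rTensor_counit_comul (R := k) (b j))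
    rw [hb] at h
    simp only [map_sum, LinearMap.rTensor_tmul, TensorProduct.lid_tmul, one_smul] at h
    rw [← h]
    exact Submodule.sum_mem _ fun i _ => Submodule.smul_mem _ _
      (Submodule.subset_span ⟨(i, j), rfl⟩)

end IsComatrix

end Comatrix

section Hopf

variable {k : Type*} [Field k] {A : Type*} [Ring A] [HopfAlgebra k A]

/-! ### Matrix corepresentations -/

namespace IsMatrixCorep

variable {n : ℕ} {t : Matrix (Fin n) (Fin n) A} (ht : IsMatrixCorep k t)
include ht

lemma antipode_mul : t.map (antipode k) * t = 1 := by
  ext i j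
  have h := HopfAlgebra.mul_antipode_rTensor_comul_apply (R := k) (t i j)
  rw [ht.comul_eq, ht.counit_eq] at h
  simp only [map_sum, LinearMap.rTensor_tmul, LinearMap.mul'_apply] at h
  simp only [Matrix.mul_apply, Matrix.map_apply, h, Matrix.one_apply]
  split_ifs <;> simp

lemma mul_antipode : t * t.map (antipode k) = 1 := by
  ext i j
  have h := HopfAlgebra.mul_antipode_lTensor_comul_apply (R := k) (t i j)
  rw [ht.comul_eq, ht.counit_eq] at h
  simp only [map_sum, LinearMap.lTensor_tmul, LinearMap.mul'_apply] at h
  simp only [Matrix.mul_apply, Matrix.map_apply, h, Matrix.one_apply]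
  split_ifs <;> simp

/-- Uniqueness of inverses in matrices over A ⊗ A: Δ(S t) is a left inverse of Δ(t) = (t ⊗ 1)(1 ⊗
t), while the product of 1 ⊗ S t and S t ⊗ 1, in this order, is a right inverse. -/
lemma comul_antipode (i j : Fin n) : comul (R := k) (antipode k (t i j)) =
    ∑ a, antipode k (t a j) ⊗ₜ[k] antipode k (t i a) := by
  let Δ : A →+* A ⊗[k] A := (Bialgebra.comulAlgHom k A : A →+* A ⊗[k] A)
  let l : A →+* A ⊗[k] A :=
    (Algebra.TensorProduct.includeLeft : A →ₐ[k] A ⊗[k] A)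
  let r : A →+* A ⊗[k] A :=
    (Algebra.TensorProduct.includeRight : A →ₐ[k] A ⊗[k] A)
  have hΔ : Δ.mapMatrix t = l.mapMatrix t * r.mapMatrix t := by
    ext i j
    simpa [Matrix.mul_apply, Δ, l, r] using ht.comul_eq i j
  have h1 : Δ.mapMatrix (t.map (antipode k)) * Δ.mapMatrix t = 1 := by
    rw [← map_mul, ht.antipode_mul, map_one]
  have h2 : Δ.mapMatrix t * (r.mapMatrix (t.map (antipode k)) *
      l.mapMatrix (t.map (antipode k))) = 1 := by
    rw [hΔ, mul_assoc, ← mul_assoc (r.mapMatrix t), ← map_mul, ht.mul_antipode, map_one, one_mul,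
      ← map_mul, ht.mul_antipode, map_one]
  have h0 := left_inv_eq_right_inv h1 h2
  have h := congrFun (congrFun h0 i) j
  simpa [Matrix.mul_apply, Δ, l, r] using h

/-- This is the coassociativity of Ad_R on entries: both tensor factors are again coefficients of
the adjoint coaction, the first carrying the inner indices and the second the outer ones. -/
lemma comul_antipode_mul (i a b j : Fin n) :
    comul (R := k) (antipode k (t i a) * t b j) =
      ∑ c, ∑ d, (antipode k (t c a) * t b d) ⊗ₜ[k] (antipode k (t i c) * t d j) := by
  rw [Bialgebra.comul_mul, ht.comul_antipode, ht.comul_eq, Finset.sum_mul_sum]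
  simp

end IsMatrixCorep

/-! ### Coquasitriangular structures as algebra maps to the convolution dual -/

/-- `a ↦ ℛ(a ⊗ ·)`, with values in the convolution algebra. -/
def leftEval (ℛ : A ⊗[k] A →ₗ[k] k) (a : A) : WithConv (A →ₗ[k] k) :=
  WithConv.toConv (ℛ ∘ₗ TensorProduct.mk k A A a)

/-- `a ↦ ℛ(· ⊗ a)`, with values in the convolution algebra. -/
def rightEval (ℛ : A ⊗[k] A →ₗ[k] k) (a : A) : WithConv (A →ₗ[k] k) :=
  WithConv.toConv (ℛ ∘ₗ (TensorProduct.mk k A A).flip a)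

@[simp]
lemma leftEval_apply (ℛ : A ⊗[k] A →ₗ[k] k) (a b : A) : leftEval ℛ a b = ℛ (a ⊗ₜ b) := rfl

@[simp]
lemma rightEval_apply (ℛ : A ⊗[k] A →ₗ[k] k) (a b : A) : rightEval ℛ a b = ℛ (b ⊗ₜ a) := rfl

/-- `a ↦ 𝒬(a ⊗ ·)`, with values in the convolution algebra. -/
def killingEval (ℛ : A ⊗[k] A →ₗ[k] k) (a : A) : WithConv (A →ₗ[k] k) :=
  WithConv.toConv (quantumKilling ℛ ∘ₗ TensorProduct.mk k A A a)

@[simp]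
lemma killingEval_apply (ℛ : A ⊗[k] A →ₗ[k] k) (a b : A) :
    killingEval ℛ a b = quantumKilling ℛ (a ⊗ₜ b) := rfl

lemma conv_apply_of_comul {f g : WithConv (A →ₗ[k] k)} {ι : Type*} {s : Finset ι} {c : A}
    {x y : ι → A} (h : comul (R := k) c = ∑ a ∈ s, x a ⊗ₜ[k] y a) :
    (f * g) c = ∑ a ∈ s, f (x a) * g (y a) := by
  simp [LinearMap.convMul_apply, h]

lemma conv_apply_of_comul₂ {f g : WithConv (A →ₗ[k] k)} {ι κ : Type*} [Fintype ι] [Fintype κ]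
    {c : A} {x y : ι → κ → A} (h : comul (R := k) c = ∑ a, ∑ b, x a b ⊗ₜ[k] y a b) :
    (f * g) c = ∑ a, ∑ b, f (x a b) * g (y a b) := by
  simp [LinearMap.convMul_apply, h]

lemma conv_sum_apply {ι : Type*} (s : Finset ι) (f : ι → WithConv (A →ₗ[k] k)) (c : A) :
    (∑ i ∈ s, f i) c = ∑ i ∈ s, f i c := by
  change (∑ i ∈ s, f i).ofConv c = _
  rw [WithConv.ofConv_sum, LinearMap.sum_apply]

/-- The definition of 𝒬 splits both arguments. Splitting only the first leaves 𝒬(c ⊗ ·) = ℛ(· ⊗ c₁)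
* ℛ(c₂ ⊗ ·), the form in which it can be cancelled against other convolution factors. -/
lemma killingEval_of_comul (ℛ : A ⊗[k] A →ₗ[k] k) {ι : Type*} {s : Finset ι} {c : A}
    {x y : ι → A} (h : comul (R := k) c = ∑ a ∈ s, x a ⊗ₜ[k] y a) :
    killingEval ℛ c = ∑ a ∈ s, rightEval ℛ (x a) * leftEval ℛ (y a) := by
  apply WithConv.ofConv_injective
  have hl (d : A ⊗[k] A) :
      LinearMap.mul' k k (TensorProduct.map (ℛ ∘ₗ (TensorProduct.comm k A A).toLinearMap) ℛ
        (TensorProduct.tensorTensorTensorComm k A A A A (comul (R := k) c ⊗ₜ d))) =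
      ∑ a ∈ s, LinearMap.mul' k k (TensorProduct.map (ℛ ∘ₗ (TensorProduct.mk k A A).flip (x a))
        (ℛ ∘ₗ TensorProduct.mk k A A (y a)) d) := by
    induction d with
    | zero => simp
    | tmul u v => simp [h, TensorProduct.sum_tmul]
    | add u v hu hv => simp only [TensorProduct.tmul_add, map_add, hu, hv, Finset.sum_add_distrib]
  ext d
  have e : quantumKilling ℛ (c ⊗ₜ d) =
    LinearMap.mul' k k (TensorProduct.map (ℛ ∘ₗ (TensorProduct.comm k A A).toLinearMap) ℛ
        (TensorProduct.tensorTensorTensorComm k A A A A (comul (R := k) c ⊗ₜ comul d))) := rfl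
  have e' : (killingEval ℛ c).ofConv d = quantumKilling ℛ (c ⊗ₜ d) := rfl
  rw [e', e, hl, WithConv.ofConv_sum, LinearMap.sum_apply]
  rfl

namespace IsCoquasitriangular

variable {ℛ : A ⊗[k] A →ₗ[k] k} (hℛ : IsCoquasitriangular ℛ)
include hℛ

lemma leftEval_mul (a b : A) : leftEval ℛ (a * b) = leftEval ℛ a * leftEval ℛ b := by
  apply WithConv.ofConv_injective
  ext c
  exact hℛ.mul_left a b c

lemma rightEval_mul (a b : A) : rightEval ℛ (a * b) = rightEval ℛ b * rightEval ℛ a := by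
  apply WithConv.ofConv_injective
  ext c
  exact hℛ.mul_right c a b

/-- Multiplicativity makes ℛ(1 ⊗ ·) idempotent, and evaluating a convolution inverse of ℛ at 1 ⊗ c
makes it right invertible, because 1 is group-like. A right invertible idempotent is 1. -/
lemma leftEval_one : leftEval ℛ 1 = 1 := by
  obtain ⟨y, hy⟩ := hℛ.isUnit.exists_right_inv
  have h : leftEval ℛ 1 * leftEval y.ofConv 1 = 1 := by
    apply WithConv.ofConv_injective
    ext c
    have hc := congrArg (fun f : WithConv (A ⊗[k] A →ₗ[k] k) => f (1 ⊗ₜ c)) hy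
    have hm (d : A ⊗[k] A) : TensorProduct.map (leftEval ℛ 1).ofConv (leftEval y.ofConv 1).ofConv d =
        TensorProduct.map ℛ y.ofConv
          (TensorProduct.tensorTensorTensorComm k A A A A ((1 ⊗ₜ 1) ⊗ₜ d)) := by
      induction d with
      | zero => simp
      | tmul u v => rfl
      | add u v hu hv => simp only [TensorProduct.tmul_add, map_add, hu, hv]
    simp only [LinearMap.convMul_apply, LinearMap.convOne_apply, TensorProduct.comul_tmul,
      TensorProduct.counit_tmul, Bialgebra.comul_one, Bialgebra.counit_one] at hc
    change LinearMap.mul' k k (TensorProduct.map (leftEval ℛ 1).ofConv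
      (leftEval y.ofConv 1).ofConv (comul c)) = algebraMap k k (counit c)
    rw [hm]
    simpa [Algebra.TensorProduct.one_def, TensorProduct.AlgebraTensorModule.tensorTensorTensorComm_eq]
      using hc
  have hi : leftEval ℛ 1 * leftEval ℛ 1 = leftEval ℛ 1 := by
    rw [← hℛ.leftEval_mul, one_mul]
  calc leftEval ℛ 1 = leftEval ℛ 1 * (leftEval ℛ 1 * leftEval y.ofConv 1) := by rw [h, mul_one]
    _ = 1 := by rw [← mul_assoc, hi, h]

/-- The same argument in the other variable: a right invertible idempotent is 1. -/
lemma rightEval_one : rightEval ℛ 1 = 1 := by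
  obtain ⟨y, hy⟩ := hℛ.isUnit.exists_right_inv
  have h : rightEval ℛ 1 * rightEval y.ofConv 1 = 1 := by
    apply WithConv.ofConv_injective
    ext c
    have hc := congrArg (fun f : WithConv (A ⊗[k] A →ₗ[k] k) => f (c ⊗ₜ 1)) hy
    have hm (d : A ⊗[k] A) :
        TensorProduct.map (rightEval ℛ 1).ofConv (rightEval y.ofConv 1).ofConv d =
          TensorProduct.map ℛ y.ofConv
            (TensorProduct.tensorTensorTensorComm k A A A A (d ⊗ₜ (1 ⊗ₜ 1))) := by
      induction d with
      | zero => simp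
      | tmul u v => rfl
      | add u v hu hv => simp only [TensorProduct.add_tmul, map_add, hu, hv]
    simp only [LinearMap.convMul_apply, LinearMap.convOne_apply, TensorProduct.comul_tmul,
      TensorProduct.counit_tmul, Bialgebra.comul_one, Bialgebra.counit_one] at hc
    change LinearMap.mul' k k (TensorProduct.map (rightEval ℛ 1).ofConv
      (rightEval y.ofConv 1).ofConv (comul c)) = algebraMap k k (counit c)
    rw [hm]
    simpa [Algebra.TensorProduct.one_def, TensorProduct.AlgebraTensorModule.tensorTensorTensorComm_eq]
      using hc
  have hi : rightEval ℛ 1 * rightEval ℛ 1 = rightEval ℛ 1 := by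
    rw [← hℛ.rightEval_mul, one_mul]
  calc rightEval ℛ 1 = rightEval ℛ 1 * (rightEval ℛ 1 * rightEval y.ofConv 1) := by
        rw [h, mul_one]
    _ = 1 := by rw [← mul_assoc, hi, h]

/-- `a ↦ ℛ(a ⊗ ·)` as an algebra map. -/
def leftHom : A →ₐ[k] WithConv (A →ₗ[k] k) :=
  AlgHom.ofLinearMap
    { toFun := leftEval ℛ
      map_add' := fun a b => by apply WithConv.ofConv_injective; ext; simp [leftEval]
      map_smul' := fun c a => by apply WithConv.ofConv_injective; ext; simp [leftEval] }
    hℛ.leftEval_one hℛ.leftEval_mul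

@[simp]
lemma leftHom_apply (a : A) : hℛ.leftHom a = leftEval ℛ a := rfl

end IsCoquasitriangular

end Hopf

/-! ### Reindexing of multiple sums -/

section Sums

variable {M : Type*} [AddCommMonoid M] {n : ℕ}

lemma sum_comm_two_two (F : Fin n → Fin n → Fin n → Fin n → M) :
    ∑ a, ∑ b, ∑ c, ∑ d, F a b c d = ∑ c, ∑ d, ∑ a, ∑ b, F a b c d := by
  simp only [← Fintype.sum_prod_type']
  exact Fintype.sum_equiv
    ⟨fun x => (x.2.2.1, x.2.2.2, x.1, x.2.1), fun x => (x.2.2.1, x.2.2.2, x.1, x.2.1),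
      fun _ => rfl, fun _ => rfl⟩ _ _ fun _ => rfl

lemma sum_comm_three_two_two (F : Fin n → Fin n → Fin n → Fin n → Fin n → Fin n → Fin n → M) :
    ∑ r, ∑ c, ∑ d, ∑ a, ∑ b, ∑ e, ∑ f, F r c d a b e f =
      ∑ e, ∑ f, ∑ a, ∑ b, ∑ r, ∑ c, ∑ d, F r c d a b e f := by
  simp only [sum_comm_two_two (fun a b e f => F _ _ _ a b e f)]
  simp only [← Fintype.sum_prod_type']
  exact Fintype.sum_equiv
    ⟨fun x => (x.2.2.2.1, x.2.2.2.2.1, x.2.2.2.2.2.1, x.2.2.2.2.2.2, x.1, x.2.1, x.2.2.1),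
      fun x => (x.2.2.2.2.1, x.2.2.2.2.2.1, x.2.2.2.2.2.2, x.1, x.2.1, x.2.2.1, x.2.2.2.1),
      fun _ => rfl, fun _ => rfl⟩ _ _ fun _ => rfl

end Sums

section Hopf

variable {k : Type*} [Field k] {A : Type*} [Ring A] [HopfAlgebra k A]
  {L : Type*} [AddCommGroup L] [Module k L] [Coalgebra k L]

lemma IsComatrix.isMatrixCorep {n : ℕ} {T : Matrix (Fin n) (Fin n) L} (hT : IsComatrix k T)
    (j : L →ₗc[k] A) : IsMatrixCorep k (T.map j) where
  comul_eq a b := by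
    rw [Matrix.map_apply, ← CoalgHomClass.map_comp_comul_apply, hT.comul_eq]
    simp
  counit_eq a b := by
    rw [Matrix.map_apply, CoalgHomClass.counit_comp_apply, hT.counit_eq]

/-! ### The cancellation between 𝒬 and the antipode -/

section Conv

variable {n : ℕ} {t : Matrix (Fin n) (Fin n) A} (ht : IsMatrixCorep k t)
  {ℛ : A ⊗[k] A →ₗ[k] k} (hℛ : IsCoquasitriangular ℛ)
include ht hℛ

/-- `𝒬(x₁ ⊗ ·) * ℛ((S x₂) x₄ ⊗ ·) = ℛ(· ⊗ x₁) * ℛ(x₃ ⊗ ·)` on matrix entries. -/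
lemma sum_killingEval_mul (i a b j : Fin n) :
    ∑ p, killingEval ℛ (t i p) * leftEval ℛ (antipode k (t p a) * t b j) =
      rightEval ℛ (t i a) * leftEval ℛ (t b j) := by
  -- The image of t · S(t) = 1 under the algebra map a ↦ ℛ(a ⊗ ·).
  have h (q : Fin n) : ∑ p, leftEval ℛ (t q p) * leftEval ℛ (antipode k (t p a)) =
      if q = a then 1 else 0 := by
    have e := congrFun (congrFun ht.mul_antipode q) a
    rw [Matrix.mul_apply] at e
    simp only [← hℛ.leftEval_mul]
    simp only [← hℛ.leftHom_apply, ← map_sum]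
    simp only [Matrix.map_apply] at e
    rw [e, Matrix.one_apply]
    split_ifs
    · exact map_one hℛ.leftHom
    · exact map_zero hℛ.leftHom
  calc ∑ p, killingEval ℛ (t i p) * leftEval ℛ (antipode k (t p a) * t b j)
      = ∑ p, ∑ q, rightEval ℛ (t i q) * (leftEval ℛ (t q p) * leftEval ℛ (antipode k (t p a))) *
          leftEval ℛ (t b j) := by
        simp only [killingEval_of_comul ℛ (ht.comul_eq _ _), hℛ.leftEval_mul, Finset.sum_mul,
          mul_assoc]
    _ = _ := by
        rw [Finset.sum_comm]
        simp only [← Finset.sum_mul, ← Finset.mul_sum, h]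
        simp

end Conv

/-! ### Coactions, braidings and the braided trace on matrix entries -/

section Formulas

variable {n : ℕ} {T : Matrix (Fin n) (Fin n) L} (hT : IsComatrix k T)
  (ℛ : A ⊗[k] A →ₗ[k] k) (j : L →ₗc[k] A)
include hT

lemma midSplit_apply (p q : Fin n) :
    midSplit (k := k) (T p q) = ∑ a, ∑ b, T a b ⊗ₜ[k] (T p a ⊗ₜ[k] T b q) := by
  simp [midSplit, hT.comul_eq, TensorProduct.tmul_sum]

lemma adR_apply (p q : Fin n) :
    adR j (T p q) = ∑ a, ∑ b, T a b ⊗ₜ[k] (antipode k (j (T p a)) * j (T b q)) := by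
  simp [adR, midSplit_apply hT]

lemma bracket_apply (x : L) (p q : Fin n) :
    bracket ℛ j (x ⊗ₜ T p q) = ∑ a, ∑ b,
      quantumKilling ℛ (j x ⊗ₜ (antipode k (j (T p a)) * j (T b q))) • T a b := by
  simp [bracket, adR_apply hT, TensorProduct.tmul_sum]

lemma catBraiding_apply (p q m l : Fin n) :
    catBraiding ℛ j (T p q ⊗ₜ T m l) = ∑ c, ∑ d, ∑ a, ∑ b,
      ℛ ((antipode k (j (T p a)) * j (T b q)) ⊗ₜ (antipode k (j (T m c)) * j (T d l))) •
        (T c d ⊗ₜ[k] T a b) := by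
  simp [catBraiding, comoduleBraiding, adR_apply hT, TensorProduct.tmul_sum,
    TensorProduct.sum_tmul]

lemma crossedAction_apply (p q : Fin n) (y : A) :
    crossedAction ℛ j (T p q ⊗ₜ y) = ∑ a, ∑ b,
      (rightEval ℛ (j (T p a)) * leftEval ℛ (j (T b q))) y • T a b := by
  have h (z : A ⊗[k] A) (a b : Fin n) :
      LinearMap.mul' k k (TensorProduct.map
        (ℛ ∘ₗ (TensorProduct.comm k A A).toLinearMap ∘ₗ j.toLinearMap.rTensor A)
        (ℛ ∘ₗ j.toLinearMap.rTensor A)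
        (TensorProduct.tensorTensorTensorComm k L L A A ((T p a ⊗ₜ T b q) ⊗ₜ z))) =
      LinearMap.mul' k k (TensorProduct.map (rightEval ℛ (j (T p a))).ofConv
        (leftEval ℛ (j (T b q))).ofConv z) := by
    induction z with
    | zero => simp
    | tmul u v => simp
    | add u v hu hv => simp only [TensorProduct.tmul_add, map_add, hu, hv]
  simp only [crossedAction, LinearMap.comp_apply, LinearEquiv.coe_coe, TensorProduct.map_tmul,
    midSplit_apply hT, TensorProduct.sum_tmul, map_sum, TensorProduct.assoc_tmul,
    LinearMap.lTensor_tmul, TensorProduct.rid_tmul, h, LinearMap.convMul_apply]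

/-- The weight ℛ((S x₂) x₄ ⊗ ·) of the categorical braiding is convolved with 𝒬(x₁ ⊗ ·) from the
bracket, and `sum_killingEval_mul` reduces the product to ℛ(· ⊗ x₁) * ℛ(x₃ ⊗ ·). This is the weight
in `crossedAction_apply`, so Ψ̃(x ⊗ y) = y₀ ⊗ (x ◁ y₁). -/
lemma assocBraiding_apply (hℛ : IsCoquasitriangular ℛ) (p q m l : Fin n) :
    assocBraiding ℛ j (T p q ⊗ₜ T m l) = ∑ e, ∑ f, ∑ a, ∑ b,
      (rightEval ℛ (j (T p a)) * leftEval ℛ (j (T b q)))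
        (antipode k (j (T m e)) * j (T f l)) • (T e f ⊗ₜ[k] T a b) := by
  have ht := hT.isMatrixCorep j
  have h (e f a b : Fin n) : (rightEval ℛ (j (T p a)) * leftEval ℛ (j (T b q)))
        (antipode k (j (T m e)) * j (T f l)) = ∑ r, ∑ c, ∑ d,
      ℛ ((antipode k (j (T r a)) * j (T b q)) ⊗ₜ (antipode k (j (T m c)) * j (T d l))) *
        quantumKilling ℛ (j (T p r) ⊗ₜ (antipode k (j (T c e)) * j (T f d))) := by
    have h1 := sum_killingEval_mul ht hℛ p a b q
    have h2 := ht.comul_antipode_mul m e f l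
    simp only [Matrix.map_apply] at h1 h2
    rw [← h1, conv_sum_apply]
    refine Finset.sum_congr rfl fun r _ => ?_
    rw [conv_apply_of_comul₂ h2]
    simp only [leftEval_apply, killingEval_apply, mul_comm]
  simp only [h, Finset.sum_smul]
  simp only [assocBraiding, LinearMap.comp_apply, LinearEquiv.coe_coe, LinearMap.rTensor_tmul,
    hT.comul_eq, TensorProduct.sum_tmul, map_sum, TensorProduct.assoc_tmul,
    LinearMap.lTensor_tmul, catBraiding_apply hT, TensorProduct.tmul_sum, TensorProduct.tmul_smul,
    map_smul, TensorProduct.assoc_symm_tmul, bracket_apply hT, ← TensorProduct.smul_tmul',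
    Finset.smul_sum, smul_smul]
  exact sum_comm_three_two_two _

lemma coeff_apply (f : Module.Dual k L) (p q : Fin n) :
    coeff j f (T p q) = ∑ a, ∑ b, f (T a b) • (antipode k (j (T p a)) * j (T b q)) := by
  simp [coeff, adR_apply hT]

lemma map_adR_apply (f : Module.Dual k L) (ω : A →ₗ[k] k) (p q : Fin n) :
    LinearMap.mul' k k (TensorProduct.map f ω (adR j (T p q))) =
      ∑ a, ∑ b, f (T a b) * ω (antipode k (j (T p a)) * j (T b q)) := by
  simp [adR_apply hT]

/-- Adjoining a bracket convolves the weight of `f(y₀) ω(y₁)` with `𝒬(x ⊗ ·)`. -/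
lemma map_adR_bracket (f : Module.Dual k L) (ω : A →ₗ[k] k) (x v : L) :
    LinearMap.mul' k k (TensorProduct.map f ω (adR j (bracket ℛ j (x ⊗ₜ v)))) =
      LinearMap.mul' k k (TensorProduct.map f
        (WithConv.toConv ω * killingEval ℛ (j x)).ofConv (adR j v)) := by
  have ht := hT.isMatrixCorep j
  have h : (LinearMap.mul' k k ∘ₗ TensorProduct.map f ω ∘ₗ adR j) ∘ₗ
      (bracket ℛ j ∘ₗ TensorProduct.mk k L L x) = LinearMap.mul' k k ∘ₗ TensorProduct.map f
        (WithConv.toConv ω * killingEval ℛ (j x)).ofConv ∘ₗ adR j := by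
    refine hT.hom_ext fun p q => ?_
    have hc (c d : Fin n) := ht.comul_antipode_mul p c d q
    simp only [Matrix.map_apply] at hc
    have hc' (c d : Fin n) :=
      conv_apply_of_comul₂ (f := WithConv.toConv ω) (g := killingEval ℛ (j x)) (hc c d)
    simp only [killingEval_apply] at hc'
    simp only [LinearMap.comp_apply, TensorProduct.mk_apply, bracket_apply hT, map_sum, map_smul,
      map_adR_apply hT, hc', smul_eq_mul, Finset.mul_sum]
    refine (sum_comm_two_two _).trans ?_
    exact Finset.sum_congr rfl fun c _ => Finset.sum_congr rfl fun d _ =>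
      Finset.sum_congr rfl fun a _ => Finset.sum_congr rfl fun b _ => by ring
  exact LinearMap.congr_fun h v

/-- The braided trace pairing `ev ∘ Ψ` is `f(v₀) u(v₁)`. -/
lemma contractLeft_comoduleBraiding [FiniteDimensional k L] (f : Module.Dual k L) (v : L) :
    contractLeft k L (comoduleBraiding ℛ (adR j) (dualCoaction j) (v ⊗ₜ f)) =
      LinearMap.mul' k k (TensorProduct.map f (drinfeldU ℛ) (adR j v)) := by
  have ht := hT.isMatrixCorep j
  -- The contraction sees the coaction on `f` only through the map x ↦ f₀(x) f₁, which is explicitly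
  -- S applied to the coefficient map.
  have hw (x : L) (y : A) (w : Module.Dual k L ⊗[k] A) :
      contractLeft k L (TensorProduct.rid k _ (TensorProduct.map
        (TensorProduct.comm k L (Module.Dual k L)).toLinearMap ℛ
        (TensorProduct.tensorTensorTensorComm k L A (Module.Dual k L) A ((x ⊗ₜ y) ⊗ₜ w)))) =
      ℛ (y ⊗ₜ dualTensorHom k L A w x) := by
    induction w with
    | zero => simp
    | tmul g a => simp [mul_comm]
    | add u v hu hv =>
      simp only [TensorProduct.tmul_add, map_add, hu, hv, LinearMap.add_apply]
  have hd (x : L) : dualTensorHom k L A (dualCoaction j f) x = antipode k (coeff j f x) := by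
    have : dualTensorHom k L A (dualCoaction j f) =
        LinearMap.compRight k (antipode k) (coeff j f) := by
      exact (dualTensorHomEquiv k L A).apply_symm_apply _
    rw [this]
    rfl
  have h : contractLeft k L ∘ₗ comoduleBraiding ℛ (adR j) (dualCoaction j) ∘ₗ
      (TensorProduct.mk k L (Module.Dual k L)).flip f =
      LinearMap.mul' k k ∘ₗ TensorProduct.map f (drinfeldU ℛ) ∘ₗ adR j := by
    refine hT.hom_ext fun p q => ?_
    have hc (c d : Fin n) := ht.comul_antipode_mul p c d q
    simp only [Matrix.map_apply] at hc
    simp only [LinearMap.comp_apply, LinearMap.flip_apply, TensorProduct.mk_apply,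
      comoduleBraiding, TensorProduct.map_tmul, adR_apply hT, TensorProduct.sum_tmul, map_sum,
      LinearEquiv.coe_coe, hw, hd, coeff_apply hT, TensorProduct.tmul_sum, map_smul,
      TensorProduct.tmul_smul, drinfeldU, hc, TensorProduct.comm_tmul, LinearMap.lTensor_tmul,
      LinearMap.mul'_apply, smul_eq_mul]
    exact sum_comm_two_two _
  exact LinearMap.congr_fun h v

omit hT [Coalgebra k L] in
lemma dualTensorHom_comm_sum_coord [FiniteDimensional k L] {ι : Type*} [Fintype ι]
    (e : Module.Basis ι k L) : dualTensorHomEquiv k L L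
      (TensorProduct.comm k L _ (∑ i, e i ⊗ₜ[k] e.coord i)) = LinearMap.id := by
  ext v
  simp [e.sum_repr]

-- `coevaluation` is built on one chosen basis. Both sides correspond to the identity under L* ⊗ L ≅
-- End L, so any basis may replace it.
omit hT [Coalgebra k L] in
lemma coevaluation_one_eq_sum [FiniteDimensional k L] {ι : Type*} [Fintype ι]
    (e : Module.Basis ι k L) : coevaluation k L 1 = ∑ i, e i ⊗ₜ[k] e.coord i := by
  apply (TensorProduct.comm k L (Module.Dual k L)).injective
  apply (dualTensorHomEquiv k L L).injective
  rw [dualTensorHom_comm_sum_coord, coevaluation_apply_one]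
  exact dualTensorHom_comm_sum_coord (Module.Basis.ofVectorSpace k L)

/-- The braided trace starts with the weight `u`. The outer bracket, with `x`, is absorbed first and
the inner one second, giving u * 𝒬(x ⊗ ·) * 𝒬(y ⊗ ·). -/
lemma braidedKilling_eq_sum [FiniteDimensional k L] {ι : Type*} [Fintype ι]
    (e : Module.Basis ι k L) (x y : L) :
    braidedKilling ℛ j x y = ∑ i, LinearMap.mul' k k (TensorProduct.map (e.coord i)
      (killingWeight ℛ (j x) (j y)) (adR j (e i))) := by
  have hK : killingWeight ℛ (j x) (j y) = (WithConv.toConv (drinfeldU ℛ) *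
      killingEval ℛ (j x) * killingEval ℛ (j y)).ofConv := by
    rw [mul_assoc]
    rfl
  rw [braidedKilling, coevaluation_one_eq_sum e, hK]
  simp only [map_sum, LinearMap.rTensor_tmul, LinearMap.comp_apply, TensorProduct.mk_apply,
    contractLeft_comoduleBraiding hT, map_adR_bracket hT]

/-- The transpose of the associated braiding is the crossed-module braiding on `L*`. -/
lemma dualDistrib_dualBraiding [FiniteDimensional k L] (hℛ : IsCoquasitriangular ℛ)
    (w : Module.Dual k L ⊗[k] Module.Dual k L) (z : L ⊗[k] L) :
    TensorProduct.dualDistrib k L L (dualBraiding ℛ j w) z =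
      TensorProduct.dualDistrib k L L w (assocBraiding ℛ j z) := by
  have hw (g : Module.Dual k L) (w : A ⊗[k] Module.Dual k L) (x y : L) :
      TensorProduct.dualDistrib k L L ((TensorProduct.lift (dualAction ℛ j)).rTensor _
        ((TensorProduct.assoc k A _ _).symm ((TensorProduct.comm k _ _).toLinearMap.lTensor A
          (TensorProduct.assoc k A _ _ (w ⊗ₜ g))))) (x ⊗ₜ y) =
      g (crossedAction ℛ j (x ⊗ₜ dualTensorHom k L A (TensorProduct.comm k _ _ w) y)) := by
    induction w with
    | zero => simp
    | tmul a f =>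
      simp [dualAction, mul_comm]
      exact Or.inl rfl
    | add u v hu hv =>
      simp only [TensorProduct.add_tmul, TensorProduct.tmul_add, map_add, hu, hv,
        LinearMap.add_apply]
  induction w with
  | zero => simp
  | add u v hu hv => simp only [map_add, LinearMap.add_apply, hu, hv]
  | tmul f g =>
    have hd : dualTensorHom k L A (TensorProduct.comm k _ _ (dualLeftCoaction j f)) =
        coeff j f := by
      simp only [dualLeftCoaction, LinearMap.comp_apply, LinearEquiv.coe_coe,
        TensorProduct.comm_comm]
      exact (dualTensorHomEquiv k L A).apply_symm_apply _
    have h : TensorProduct.dualDistrib k L L (dualBraiding ℛ j (f ⊗ₜ g)) =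
        TensorProduct.dualDistrib k L L (f ⊗ₜ g) ∘ₗ assocBraiding ℛ j := by
      refine hT.hom_ext₂ fun p q m l => ?_
      simp only [dualBraiding, LinearMap.comp_apply, LinearMap.rTensor_tmul, LinearEquiv.coe_coe,
        hw, hd, assocBraiding_apply hT ℛ j hℛ, coeff_apply hT, TensorProduct.tmul_sum, map_sum,
        TensorProduct.tmul_smul, map_smul, crossedAction_apply hT,
        TensorProduct.dualDistrib_apply, smul_eq_mul, Finset.mul_sum]
      refine Finset.sum_congr rfl fun e _ => Finset.sum_congr rfl fun f _ =>
        Finset.sum_congr rfl fun a _ => Finset.sum_congr rfl fun b _ => mul_left_comm _ _ _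
    exact LinearMap.congr_fun h z

lemma perp_envRel [FiniteDimensional k L] (hℛ : IsCoquasitriangular ℛ) :
    perp (envRel ℛ j) = extRel ℛ j :=
  perp_range_id_sub _ _ (dualDistrib_dualBraiding hT ℛ j hℛ)

end Formulas

end Hopf

/-! ### Reindexing for the R-matrix formulas -/

section Sums

variable {M : Type*} [AddCommMonoid M] {n : ℕ}

lemma sum_comm_exchange
    (F : Fin n → Fin n → Fin n → Fin n → Fin n → Fin n → Fin n → Fin n → M) :
    ∑ k₂, ∑ k₃, ∑ i₂, ∑ i₃, ∑ k₁, ∑ k₄, ∑ i₁, ∑ i₄, F k₁ k₂ k₃ k₄ i₁ i₂ i₃ i₄ =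
      ∑ k₁, ∑ k₂, ∑ k₃, ∑ k₄, ∑ i₁, ∑ i₂, ∑ i₃, ∑ i₄, F k₁ k₂ k₃ k₄ i₁ i₂ i₃ i₄ := by
  simp only [← Fintype.sum_prod_type']
  exact Fintype.sum_equiv
    ⟨fun x => (x.2.2.2.2.1, x.1, x.2.1, x.2.2.2.2.2.1, x.2.2.2.2.2.2.1, x.2.2.1, x.2.2.2.1,
        x.2.2.2.2.2.2.2),
      fun x => (x.2.1, x.2.2.1, x.2.2.2.2.2.1, x.2.2.2.2.2.2.1, x.1, x.2.2.2.1, x.2.2.2.2.1,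
        x.2.2.2.2.2.2.2),
      fun _ => rfl, fun _ => rfl⟩ _ _ fun _ => rfl

lemma sum_comm_reflection
    (F : Fin n → Fin n → Fin n → Fin n → Fin n → Fin n → Fin n → Fin n → M) :
    ∑ k₁, ∑ k₂, ∑ k₃, ∑ k₄, ∑ i₁, ∑ i₂, ∑ i₃, ∑ i₄, F k₁ i₄ k₂ i₁ k₃ k₄ i₂ i₃ =
      ∑ k₁, ∑ i₄, ∑ k₂, ∑ i₁, ∑ k₃, ∑ k₄, ∑ i₂, ∑ i₃, F k₁ i₄ k₂ i₁ k₃ k₄ i₂ i₃ := by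
  simp only [← Fintype.sum_prod_type']
  exact Fintype.sum_equiv
    ⟨fun x => (x.1, x.2.2.2.2.2.2.2, x.2.1, x.2.2.2.2.1, x.2.2.1, x.2.2.2.1, x.2.2.2.2.2.1,
        x.2.2.2.2.2.2.1),
      fun x => (x.1, x.2.2.1, x.2.2.2.2.1, x.2.2.2.2.2.1, x.2.2.2.1, x.2.2.2.2.2.2.1,
        x.2.2.2.2.2.2.2, x.2.1),
      fun _ => rfl, fun _ => rfl⟩ _ _ fun _ => rfl

lemma sum_comm_bracket (F : Fin n → Fin n → Fin n → Fin n → Fin n → Fin n → Fin n → M) :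
    ∑ k₂, ∑ k₃, ∑ i₂, ∑ k₁, ∑ k₄, ∑ i₁, ∑ i₃, F k₁ k₂ k₃ k₄ i₁ i₂ i₃ =
      ∑ k₁, ∑ k₂, ∑ k₃, ∑ k₄, ∑ i₁, ∑ i₂, ∑ i₃, F k₁ k₂ k₃ k₄ i₁ i₂ i₃ := by
  simp only [← Fintype.sum_prod_type']
  exact Fintype.sum_equiv
    ⟨fun x => (x.2.2.2.1, x.1, x.2.1, x.2.2.2.2.1, x.2.2.2.2.2.1, x.2.2.1, x.2.2.2.2.2.2),
      fun x => (x.2.1, x.2.2.1, x.2.2.2.2.2.1, x.1, x.2.2.2.1, x.2.2.2.2.1, x.2.2.2.2.2.2),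
      fun _ => rfl, fun _ => rfl⟩ _ _ fun _ => rfl

end Sums

section Hopf

variable {k : Type*} [Field k] {A : Type*} [Ring A] [HopfAlgebra k A]

/-! ### The matrices `R`, `R⁻¹` and `R̃` -/

section RMatrix

variable {n : ℕ} {t : Matrix (Fin n) (Fin n) A} (ht : IsMatrixCorep k t)
  {ℛ : A ⊗[k] A →ₗ[k] k} (hℛ : IsCoquasitriangular ℛ)
include ht

/-- An algebra map, applied to `S t` and `t`, gives inverse matrices. -/
lemma IsMatrixCorep.map_antipode_mul {C : Type*} [Ring C] [Algebra k C] (φ : A →ₐ[k] C)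
    (i l : Fin n) : ∑ a, φ (antipode k (t i a)) * φ (t a l) = if i = l then 1 else 0 := by
  have e := congrFun (congrFun ht.antipode_mul i) l
  rw [Matrix.mul_apply] at e
  simp only [← map_mul, ← map_sum]
  simp only [Matrix.map_apply] at e
  rw [e, Matrix.one_apply]
  split_ifs <;> simp

include hℛ

omit ht in
lemma tmul_one_apply (a : A) (m l : Fin n) :
    ℛ (a ⊗ₜ (1 : Matrix (Fin n) (Fin n) A) m l) =
      counit a * (1 : Matrix (Fin n) (Fin n) k) m l := by
  rw [Matrix.one_apply, Matrix.one_apply]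
  split_ifs
  · rw [← rightEval_apply, hℛ.rightEval_one, LinearMap.convOne_apply, mul_one,
      Algebra.algebraMap_self_apply]
  · simp

/-- Apply the algebra map a ↦ ℛ(a ⊗ ·) to S(t) · t = 1 and evaluate on an entry of `t`. -/
lemma inv_mul_rMatrix :
    (Matrix.of fun p q : Fin n × Fin n => ℛ (antipode k (t p.1 q.1) ⊗ₜ t p.2 q.2)) *
      rMatrix ℛ t = 1 := by
  ext ⟨i, m⟩ ⟨j, l⟩
  have h := congrArg (fun f : WithConv (A →ₗ[k] k) => f (t m l))
    (ht.map_antipode_mul hℛ.leftHom i j)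
  simp only [conv_sum_apply, IsCoquasitriangular.leftHom_apply,
    conv_apply_of_comul (ht.comul_eq m l), leftEval_apply] at h
  rw [Matrix.mul_apply, Fintype.sum_prod_type]
  refine h.trans ?_
  split_ifs with hij
  · subst hij
    rw [LinearMap.convOne_apply, ht.counit_eq, Matrix.one_apply, Matrix.one_apply]
    simp
  · rw [Matrix.one_apply_ne (by simp [hij])]
    rfl

lemma isUnit_rMatrix : IsUnit (rMatrix ℛ t) :=
  IsUnit.of_mul_eq_one_right _ (inv_mul_rMatrix ht hℛ)

lemma rMatrix_inv :
    (rMatrix ℛ t)⁻¹ =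
      Matrix.of fun p q : Fin n × Fin n => ℛ (antipode k (t p.1 q.1) ⊗ₜ t p.2 q.2) :=
  Matrix.inv_eq_left_inv (inv_mul_rMatrix ht hℛ)

lemma rMatrix_inv_apply (i m j l : Fin n) :
    (rMatrix ℛ t)⁻¹ (i, m) (j, l) = ℛ (antipode k (t i j) ⊗ₜ t m l) := by
  rw [rMatrix_inv ht hℛ]
  rfl

/-- Anti-multiplicativity in the second argument, applied to S(t) · t = 1 with an entry of S(t) in
the first, makes this matrix a left inverse of R⁻¹, hence equal to R. -/
lemma antipode_tmul_antipode (i j m l : Fin n) :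
    ℛ (antipode k (t i j) ⊗ₜ antipode k (t m l)) = rMatrix ℛ t (i, m) (j, l) := by
  have h : (Matrix.of fun p q : Fin n × Fin n =>
      ℛ (antipode k (t p.1 q.1) ⊗ₜ antipode k (t p.2 q.2))) * (rMatrix ℛ t)⁻¹ = 1 := by
    ext ⟨i, m⟩ ⟨j, l⟩
    have e := congrFun (congrFun ht.antipode_mul m) l
    rw [Matrix.mul_apply] at e
    simp only [Matrix.map_apply] at e
    have e' := congrArg (fun a => ℛ (antipode k (t i j) ⊗ₜ a)) e
    simp only [TensorProduct.tmul_sum, map_sum, ← rightEval_apply ℛ (_ * _),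
      hℛ.rightEval_mul, conv_apply_of_comul (ht.comul_antipode i j), rightEval_apply] at e'
    rw [Matrix.mul_apply, Fintype.sum_prod_type, Finset.sum_comm]
    simp only [rMatrix_inv_apply ht hℛ, Matrix.of_apply]
    simp only [mul_comm] at e' ⊢
    rw [e', tmul_one_apply hℛ, HopfAlgebra.counit_antipode, ht.counit_eq, Matrix.one_apply,
      Matrix.one_apply, Matrix.one_apply]
    simp only [Prod.mk.injEq, ← ite_and, mul_ite, mul_one, mul_zero]
    simp only [and_comm]
  have h' := Matrix.inv_eq_left_inv h
  rw [Matrix.nonsing_inv_nonsing_inv _ ((Matrix.isUnit_iff_isUnit_det _).1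
    (isUnit_rMatrix ht hℛ))] at h'
  rw [h']
  rfl

/-- `R̃` is the inverse of `R` with respect to the second and third index pairs. -/
lemma rTilde_mul_rMatrix :
    (Matrix.of fun p q : Fin n × Fin n => rTilde ℛ t (q.2, p.2) (p.1, q.1)) *
      (Matrix.of fun p q : Fin n × Fin n => rMatrix ℛ t (q.1, p.1) (p.2, q.2)) = 1 := by
  ext ⟨j, m⟩ ⟨i, l⟩
  have e := congrFun (congrFun ht.antipode_mul m) l
  rw [Matrix.mul_apply] at e
  simp only [Matrix.map_apply] at e
  have e' := congrArg (fun a => ℛ (t i j ⊗ₜ a)) e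
  simp only [TensorProduct.tmul_sum, map_sum, ← rightEval_apply ℛ (_ * _),
    hℛ.rightEval_mul, conv_apply_of_comul (ht.comul_eq i j), rightEval_apply] at e'
  rw [Matrix.mul_apply, Fintype.sum_prod_type]
  simp only [rMatrix, rTilde, Matrix.of_apply]
  simp only [mul_comm] at e' ⊢
  rw [e', tmul_one_apply hℛ, ht.counit_eq, Matrix.one_apply, Matrix.one_apply, Matrix.one_apply]
  simp only [Prod.mk.injEq, ← ite_and, mul_ite, mul_one, mul_zero]
  simp only [and_comm, eq_comm]

/-- Multiplicativity in the argument holding the product, with the coproduct of the other argument,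
leaves two R-matrix factors. This and the next two evaluations supply all factors of the final
formulas. -/
lemma rightEval_antipode_mul_apply (a b c d i j : Fin n) :
    rightEval ℛ (t i j) (antipode k (t a b) * t c d) =
      ∑ e, (rMatrix ℛ t)⁻¹ (a, i) (b, e) * rMatrix ℛ t (c, e) (d, j) := by
  rw [rightEval_apply, ← leftEval_apply, hℛ.leftEval_mul, conv_apply_of_comul (ht.comul_eq i j)]
  simp only [rMatrix_inv_apply ht hℛ]
  rfl

lemma leftEval_antipode_mul_apply (a b c d i j : Fin n) :
    leftEval ℛ (t i j) (antipode k (t a b) * t c d) =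
      ∑ e, rMatrix ℛ t (i, c) (e, d) * rTilde ℛ t (e, a) (j, b) := by
  rw [leftEval_apply, ← rightEval_apply, hℛ.rightEval_mul, conv_apply_of_comul (ht.comul_eq i j)]
  rfl

lemma leftEval_antipode_antipode_mul_apply (a b c d i j : Fin n) :
    leftEval ℛ (antipode k (t i j)) (antipode k (t a b) * t c d) =
      ∑ e, (rMatrix ℛ t)⁻¹ (e, c) (j, d) * rMatrix ℛ t (i, a) (e, b) := by
  rw [leftEval_apply, ← rightEval_apply, hℛ.rightEval_mul,
    conv_apply_of_comul (ht.comul_antipode i j)]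
  simp only [rightEval_apply, rMatrix_inv_apply ht hℛ, antipode_tmul_antipode ht hℛ]

lemma braidingWeight_apply (i i₂ i₃ j m k₂ k₃ l : Fin n) :
    (rightEval ℛ (t i i₂) * leftEval ℛ (t i₃ j)) (antipode k (t m k₂) * t k₃ l) =
      ∑ k₁, ∑ k₄, ∑ i₁, ∑ i₄, (rMatrix ℛ t)⁻¹ (k₁, i) (k₂, i₁) * rMatrix ℛ t (k₃, i₁) (k₄, i₂) *
        rMatrix ℛ t (i₃, k₄) (i₄, l) * rTilde ℛ t (i₄, m) (j, k₁) := by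
  rw [conv_apply_of_comul₂ (ht.comul_antipode_mul m k₂ k₃ l)]
  simp only [rightEval_antipode_mul_apply ht hℛ, leftEval_antipode_mul_apply ht hℛ,
    Finset.sum_mul_sum, mul_assoc]

/-- 𝒬 is the contraction of the braiding weights over i₂ = i₃, hence one index fewer than for the
braiding. -/
lemma bracketWeight_apply (i j m k₂ k₃ l : Fin n) :
    quantumKilling ℛ (t i j ⊗ₜ (antipode k (t m k₂) * t k₃ l)) =
      ∑ i₂, ∑ k₁, ∑ k₄, ∑ i₁, ∑ i₃, (rMatrix ℛ t)⁻¹ (k₁, i) (k₂, i₁) *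
        rMatrix ℛ t (k₃, i₁) (k₄, i₂) * rMatrix ℛ t (i₂, k₄) (i₃, l) *
        rTilde ℛ t (i₃, m) (j, k₁) := by
  rw [← killingEval_apply, killingEval_of_comul ℛ (ht.comul_eq i j), conv_sum_apply]
  simp only [braidingWeight_apply ht hℛ]

lemma catWeight_apply (i i₂ i₃ j m k₂ k₃ l : Fin n) :
    ℛ ((antipode k (t i i₂) * t i₃ j) ⊗ₜ (antipode k (t m k₂) * t k₃ l)) =
      ∑ k₁, ∑ k₄, ∑ i₁, ∑ i₄, rMatrix ℛ t (i, k₁) (i₁, k₂) * (rMatrix ℛ t)⁻¹ (i₁, k₃) (i₂, k₄) *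
        rMatrix ℛ t (i₃, k₄) (i₄, l) * rTilde ℛ t (i₄, m) (j, k₁) := by
  rw [← leftEval_apply, hℛ.leftEval_mul,
    conv_apply_of_comul₂ (ht.comul_antipode_mul m k₂ k₃ l)]
  simp only [leftEval_antipode_antipode_mul_apply ht hℛ, leftEval_antipode_mul_apply ht hℛ,
    Finset.sum_mul_sum]
  refine Finset.sum_congr rfl fun _ _ => Finset.sum_congr rfl fun _ _ =>
    Finset.sum_congr rfl fun _ _ => Finset.sum_congr rfl fun _ _ => by ring

end RMatrix

/-! ### The reflection equation -/

section Reflection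

variable {n : ℕ} {t : Matrix (Fin n) (Fin n) A} {ℛ : A ⊗[k] A →ₗ[k] k}
  {B : Type*} [Ring B] [Algebra k B]

lemma mul_kronecker_one_apply (P : Matrix (Fin n × Fin n) (Fin n × Fin n) B)
    (u : Matrix (Fin n) (Fin n) B) (p : Fin n × Fin n) (c b : Fin n) :
    (P * (u ⊗ₖ (1 : Matrix (Fin n) (Fin n) B))) p (c, b) = ∑ a, P p (a, b) * u a c := by
  rw [Matrix.mul_apply, Fintype.sum_prod_type]
  refine Finset.sum_congr rfl fun a _ => ?_
  rw [Finset.sum_eq_single b]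
  · simp [Matrix.kroneckerMap_apply]
  · intro d _ hd
    simp [Matrix.kroneckerMap_apply, Matrix.one_apply_ne hd]
  · simp

lemma mul_one_kronecker_apply (P : Matrix (Fin n × Fin n) (Fin n × Fin n) B)
    (u : Matrix (Fin n) (Fin n) B) (p : Fin n × Fin n) (j l : Fin n) :
    (P * ((1 : Matrix (Fin n) (Fin n) B) ⊗ₖ u)) p (j, l) = ∑ d, P p (j, d) * u d l := by
  rw [Matrix.mul_apply, Fintype.sum_prod_type, Finset.sum_eq_single j]
  · simp [Matrix.kroneckerMap_apply]
  · intro d _ hd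
    simp [Matrix.kroneckerMap_apply, Matrix.one_apply_ne hd]
  · simp

lemma one_kronecker_mul_apply (P : Matrix (Fin n × Fin n) (Fin n × Fin n) B)
    (u : Matrix (Fin n) (Fin n) B) (p : Fin n × Fin n) (i m : Fin n) :
    (((1 : Matrix (Fin n) (Fin n) B) ⊗ₖ u) * P) (i, m) p = ∑ b, u m b * P (i, b) p := by
  rw [Matrix.mul_apply, Fintype.sum_prod_type, Finset.sum_eq_single i]
  · simp [Matrix.kroneckerMap_apply]
  · intro d _ hd
    simp [Matrix.kroneckerMap_apply, Matrix.one_apply_ne hd.symm]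
  · simp

lemma reflLeft_apply (R : Matrix (Fin n × Fin n) (Fin n × Fin n) k) (u : Matrix (Fin n) (Fin n) B)
    (i m j l : Fin n) : reflLeft R u (i, m) (j, l) =
      ∑ b, ∑ a, ∑ c, ∑ d, (R (m, i) (b, a) * R (c, b) (j, d)) • (u a c * u d l) := by
  rw [reflLeft, mul_one_kronecker_apply]
  simp only [Matrix.mul_apply (M := _ * _ ⊗ₖ _), Fintype.sum_prod_type, mul_kronecker_one_apply,
    Matrix.map_apply, Matrix.submatrix_apply, Prod.swap_prod_mk, ← Algebra.smul_def,
    ← Algebra.commutes, Finset.sum_mul, Finset.smul_sum, smul_mul_assoc, smul_smul]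
  refine (sum_comm_two_two _).trans ?_
  refine Finset.sum_congr rfl fun b _ => Finset.sum_congr rfl fun a _ => ?_
  rw [Finset.sum_comm]
  simp only [mul_comm]

lemma reflRight_apply (R : Matrix (Fin n × Fin n) (Fin n × Fin n) k)
    (u : Matrix (Fin n) (Fin n) B) (i m j l : Fin n) : reflRight R u (i, m) (j, l) =
      ∑ b, ∑ d, ∑ a, ∑ c, (R (b, i) (d, a) * R (c, d) (j, l)) • (u m b * u a c) := by
  rw [reflRight, mul_assoc, mul_assoc, one_kronecker_mul_apply]
  simp only [← mul_assoc, Matrix.mul_apply (M := _ * _ ⊗ₖ _), Fintype.sum_prod_type,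
    mul_kronecker_one_apply,
    Matrix.map_apply, Matrix.submatrix_apply, Prod.swap_prod_mk, ← Algebra.smul_def,
    ← Algebra.commutes, Finset.mul_sum, Finset.smul_sum, mul_smul_comm, smul_smul]
  refine Finset.sum_congr rfl fun b _ => ?_
  rw [Finset.sum_comm]
  refine Finset.sum_congr rfl fun d _ => ?_
  rw [Finset.sum_comm]
  simp only [mul_comm]

lemma map_reflLeft {C : Type*} [Ring C] [Algebra k C] (f : B →ₐ[k] C)
    (R : Matrix (Fin n × Fin n) (Fin n × Fin n) k) (u : Matrix (Fin n) (Fin n) B)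
    (p q : Fin n × Fin n) :
    f (reflLeft R u p q) = reflLeft R (u.map f) p q := by
  obtain ⟨i, m⟩ := p
  obtain ⟨j, l⟩ := q
  simp only [reflLeft_apply, map_sum, map_smul, map_mul, Matrix.map_apply]

lemma map_reflRight {C : Type*} [Ring C] [Algebra k C] (f : B →ₐ[k] C)
    (R : Matrix (Fin n × Fin n) (Fin n × Fin n) k) (u : Matrix (Fin n) (Fin n) B)
    (p q : Fin n × Fin n) :
    f (reflRight R u p q) = reflRight R (u.map f) p q := by
  obtain ⟨i, m⟩ := p
  obtain ⟨j, l⟩ := q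
  simp only [reflRight_apply, map_sum, map_smul, map_mul, Matrix.map_apply]

lemma map_exchange {C : Type*} [Ring C] [Algebra k C] (f : B →ₐ[k] C)
    (u : Matrix (Fin n) (Fin n) B) (i j m l : Fin n) :
    f (exchange ℛ t u i j m l) = exchange ℛ t (u.map f) i j m l := by
  simp only [exchange, map_sum, map_smul, map_mul, Matrix.map_apply]

/-- Inverse matrices over `k` act inversely on vectors over a `k`-algebra. -/
lemma mulVec_eq_iff {ι : Type*} [Fintype ι] [DecidableEq ι] {M N : Matrix ι ι k} (h : N * M = 1)
    (v w : ι → B) :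
    (∀ p, ∑ q, M p q • v q = w p) ↔ ∀ p, v p = ∑ q, N p q • w q := by
  have key {M N : Matrix ι ι k} (h : N * M = 1) (v : ι → B) (p : ι) :
      ∑ q, N p q • ∑ r, M q r • v r = v p := by
    simp only [Finset.smul_sum, smul_smul]
    rw [Finset.sum_comm]
    simp only [← Finset.sum_smul, ← Matrix.mul_apply, h, Matrix.one_apply, ite_smul, one_smul,
      zero_smul, Finset.sum_ite_eq, Finset.mem_univ, if_true]
  constructor
  · intro e p
    simp only [← e, key h]
  · intro e p
    simp only [e, key (mul_eq_one_comm.1 h)]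

/-- The exchange relations are equivalent to the reflection equation. -/
lemma reflLeft_eq_reflRight_iff (ht : IsMatrixCorep k t) (hℛ : IsCoquasitriangular ℛ)
    (u : Matrix (Fin n) (Fin n) B) :
    (∀ p q, reflLeft (rMatrix ℛ t) u p q = reflRight (rMatrix ℛ t) u p q) ↔
      ∀ i j m l, u i j * u m l = exchange ℛ t u i j m l := by
  set R := rMatrix ℛ t with hR
  have hinv : R⁻¹ * R = 1 :=
    Matrix.nonsing_inv_mul _ ((Matrix.isUnit_iff_isUnit_det _).1 (isUnit_rMatrix ht hℛ))
  -- The left side of the reflection equation is R₂₁ applied to an inner R acting on the products of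
  -- generators. `h1` inverts the outer factor by R⁻¹ with `j`, `l` fixed; `h2` inverts the inner
  -- one by R̃ with `a`, `l` fixed.
  have h1 := fun (j l : Fin n) => mulVec_eq_iff hinv
    (fun ba : Fin n × Fin n => ∑ q : Fin n × Fin n, R (q.1, ba.1) (j, q.2) •
      (u ba.2 q.1 * u q.2 l))
    (fun mi => reflRight R u (mi.2, mi.1) (j, l))
  have h2 := fun (a l : Fin n) => mulVec_eq_iff (rTilde_mul_rMatrix ht hℛ)
    (fun q : Fin n × Fin n => u a q.1 * u q.2 l)
    (fun bj => ∑ q, R⁻¹ (bj.1, a) q • reflRight R u (q.2, q.1) (bj.2, l))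
  simp only [Prod.forall, Matrix.of_apply, ← hR] at h1 h2
  have hl (i m j l : Fin n) : reflLeft R u (i, m) (j, l) = ∑ q : Fin n × Fin n, R (m, i) q •
      ∑ q' : Fin n × Fin n, R (q'.1, q.1) (j, q'.2) • (u q.2 q'.1 * u q'.2 l) := by
    simp only [reflLeft_apply, Fintype.sum_prod_type, Finset.smul_sum, smul_smul]
  have hr (i j m l : Fin n) : exchange ℛ t u i j m l = ∑ q : Fin n × Fin n,
      rTilde ℛ t (q.2, m) (j, q.1) •
        ∑ q', R⁻¹ (q.1, i) q' • reflRight R u (q'.2, q'.1) (q.2, l) := by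
    simp only [reflRight_apply, Fintype.sum_prod_type, Finset.smul_sum, smul_smul, exchange]
    have hc (a b c d : k) : d * (a * (b * c)) = a * b * c * d := by ring
    simp only [hc, ← hR]
    exact sum_comm_reflection _
  constructor
  · intro h i j m l
    rw [hr]
    refine (h2 i l).1 (fun b c => ?_) j m
    refine (h1 c l).1 (fun m i => ?_) b i
    rw [← h, hl]
  · rintro h ⟨i, m⟩ ⟨j, l⟩
    rw [hl]
    refine (h1 j l).2 (fun b a => ?_) m i
    exact (h2 a l).2 (fun c d => by rw [h, hr]) b j

end Reflection

end Hopf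

section Hopf

variable {k : Type*} [Field k] {A : Type*} [Ring A] [HopfAlgebra k A]

/-! ### Generators and relations of the enveloping algebra -/

section Env

variable {L : Type*} [AddCommGroup L] [Module k L] [Coalgebra k L] {n : ℕ}
  {T : Matrix (Fin n) (Fin n) L} (hT : IsComatrix k T)

include hT in
/-- A matrix `v` with the linear relations of `T` is the image of `T` under a linear map. -/
lemma IsComatrix.exists_linearMap {D : Type*} [AddCommGroup D] [Module k D]
    (v : Matrix (Fin n) (Fin n) D)
    (hv : ∀ c : Fin n → Fin n → k, ∑ i, ∑ j, c i j • T i j = 0 → ∑ i, ∑ j, c i j • v i j = 0) :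
    ∃ q : L →ₗ[k] D, ∀ i j, q (T i j) = v i j := by
  let P := Fintype.linearCombination k (fun p : Fin n × Fin n => T p.1 p.2)
  let Q := Fintype.linearCombination k (fun p : Fin n × Fin n => v p.1 p.2)
  have hPQ (c : Fin n × Fin n → k) (hc : P c = 0) : Q c = 0 := by
    have := hv fun i j => c (i, j)
    simp only [P, Q, Fintype.linearCombination_apply, Fintype.sum_prod_type] at this hc ⊢
    exact this hc
  have hP : LinearMap.range P = ⊤ := by
    rw [Fintype.range_linearCombination, hT.span_eq]
  obtain ⟨s, hs⟩ := P.exists_rightInverse_of_surjective hP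
  refine ⟨Q ∘ₗ s, fun i j => ?_⟩
  -- The section `s` expresses `T i j` by some coefficients. These differ from the obvious ones by a
  -- linear relation among the entries, which `Q` kills.
  have h := hPQ (s (T i j) - Pi.single (i, j) 1) (by
    rw [map_sub, ← LinearMap.comp_apply, hs]
    simp [P])
  rw [map_sub, sub_eq_zero] at h
  rw [LinearMap.comp_apply, h]
  simp [Q]

variable (ℛ : A ⊗[k] A →ₗ[k] k) (j : L →ₗc[k] A)

include hT in
lemma bracket_entry (hℛ : IsCoquasitriangular ℛ) (p q m l : Fin n) :
    bracket ℛ j (T p q ⊗ₜ T m l) =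
      ∑ k₁, ∑ k₂, ∑ k₃, ∑ k₄, ∑ i₁, ∑ i₂, ∑ i₃,
        ((rMatrix ℛ (T.map j))⁻¹ (k₁, p) (k₂, i₁) * rMatrix ℛ (T.map j) (k₃, i₁) (k₄, i₂) *
          rMatrix ℛ (T.map j) (i₂, k₄) (i₃, l) * rTilde ℛ (T.map j) (i₃, m) (q, k₁)) •
            T k₂ k₃ := by
  have h := bracketWeight_apply (hT.isMatrixCorep j) hℛ
  simp only [Matrix.map_apply] at h
  simp only [bracket_apply hT, h, Finset.sum_smul]
  exact sum_comm_bracket _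

include hT in
lemma catBraiding_entry (hℛ : IsCoquasitriangular ℛ) (p q m l : Fin n) :
    catBraiding ℛ j (T p q ⊗ₜ T m l) =
      ∑ k₁, ∑ k₂, ∑ k₃, ∑ k₄, ∑ i₁, ∑ i₂, ∑ i₃, ∑ i₄,
        (rMatrix ℛ (T.map j) (p, k₁) (i₁, k₂) * (rMatrix ℛ (T.map j))⁻¹ (i₁, k₃) (i₂, k₄) *
          rMatrix ℛ (T.map j) (i₃, k₄) (i₄, l) * rTilde ℛ (T.map j) (i₄, m) (q, k₁)) •
            (T k₂ k₃ ⊗ₜ[k] T i₂ i₃) := by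
  have h := catWeight_apply (hT.isMatrixCorep j) hℛ
  simp only [Matrix.map_apply] at h
  simp only [catBraiding_apply hT, h, Finset.sum_smul]
  exact sum_comm_exchange _

-- An arbitrary linear map `f` into an algebra is allowed, so that the same formula gives both the
-- relations holding in U(L) and the criterion for a map out of it.
include hT in
lemma mul_map_assocBraiding (hℛ : IsCoquasitriangular ℛ) {D : Type*} [Ring D] [Algebra k D]
    (f : L →ₗ[k] D) (p q m l : Fin n) :
    LinearMap.mul' k D (TensorProduct.map f f (assocBraiding ℛ j (T p q ⊗ₜ T m l))) =
      exchange ℛ (T.map j) (T.map f) p q m l := by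
  have h := braidingWeight_apply (hT.isMatrixCorep j) hℛ
  simp only [Matrix.map_apply] at h
  simp only [assocBraiding_apply hT ℛ j hℛ, h, Finset.sum_smul, map_sum, map_smul,
    TensorProduct.map_tmul, LinearMap.mul'_apply]
  exact sum_comm_exchange _

include hT in
lemma gen_mul_gen (hℛ : IsCoquasitriangular ℛ) (p q m l : Fin n) :
    QuadAlg.gen (envRel ℛ j) (T p q) * QuadAlg.gen (envRel ℛ j) (T m l) =
      exchange ℛ (T.map j) (T.map (QuadAlg.gen (envRel ℛ j))) p q m l := by
  have h := QuadAlg.mul_gen_eq_zero (envRel ℛ j) (z := T p q ⊗ₜ T m l -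
    assocBraiding ℛ j (T p q ⊗ₜ T m l)) ⟨T p q ⊗ₜ T m l, rfl⟩
  rw [map_sub, map_sub, mul_map_assocBraiding hT ℛ j hℛ, sub_eq_zero] at h
  simpa using h

include hT in
/-- The universal property of `U(L)` by generators and relations. -/
lemma exists_lift_env (hℛ : IsCoquasitriangular ℛ) {D : Type*} [Ring D] [Algebra k D]
    (v : Matrix (Fin n) (Fin n) D)
    (hv : ∀ c : Fin n → Fin n → k, ∑ i, ∑ j, c i j • T i j = 0 → ∑ i, ∑ j, c i j • v i j = 0)
    (hx : ∀ p q m l, v p q * v m l = exchange ℛ (T.map j) v p q m l) :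
    ∃ ψ : Env ℛ j →ₐ[k] D, ∀ p q, ψ (QuadAlg.gen (envRel ℛ j) (T p q)) = v p q := by
  obtain ⟨f, hf⟩ := hT.exists_linearMap v hv
  have hfv : T.map f = v := Matrix.ext hf
  refine ⟨QuadAlg.lift _ f ?_, fun p q => (QuadAlg.lift_gen _ _ _ _).trans (hf p q)⟩
  have h : LinearMap.mul' k D ∘ₗ TensorProduct.map f f ∘ₗ assocBraiding ℛ j =
      LinearMap.mul' k D ∘ₗ TensorProduct.map f f := by
    refine hT.hom_ext₂ fun p q m l => ?_
    simp only [LinearMap.comp_apply, mul_map_assocBraiding hT ℛ j hℛ, hfv,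
      TensorProduct.map_tmul, LinearMap.mul'_apply, hf, hx]
  rintro _ ⟨z, rfl⟩
  have hz := LinearMap.congr_fun h z
  simp only [LinearMap.comp_apply] at hz
  rw [LinearMap.sub_apply, LinearMap.id_apply, map_sub, map_sub, hz, sub_self]

include hT in
lemma IsComatrix.surjective_env {D : Type*} [Ring D] [Algebra k D] {S : Submodule k (L ⊗[k] L)}
    (φ : D →ₐ[k] QuadAlg S) (d : Fin n → Fin n → D)
    (h : ∀ p q, φ (d p q) = QuadAlg.gen S (T p q)) : Function.Surjective φ := by
  refine QuadAlg.surjective_of_range φ fun x => ?_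
  have hx : x ∈ Submodule.span k (Set.range fun p : Fin n × Fin n => T p.1 p.2) :=
    hT.span_eq ▸ Submodule.mem_top
  have hle : Submodule.span k (Set.range fun p : Fin n × Fin n => T p.1 p.2) ≤
      (LinearMap.range φ.toLinearMap).comap (QuadAlg.gen S) := by
    rw [Submodule.span_le]
    rintro _ ⟨p, rfl⟩
    exact ⟨d p.1 p.2, h _ _⟩
  exact hle hx

include hT in
/-- If `φ : D → U(L)` sends a matrix `d` of generators of `D` to `T`, and `D` modulo the ideal
generated by `s` satisfies the relations of `U(L)`, then that ideal is the kernel of `φ`. -/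
lemma ker_eq_span_of_relations (hℛ : IsCoquasitriangular ℛ) {D : Type*} [Ring D] [Algebra k D]
    (φ : D →ₐ[k] Env ℛ j) (d : Matrix (Fin n) (Fin n) D)
    (hφ : ∀ p q, φ (d p q) = QuadAlg.gen (envRel ℛ j) (T p q))
    (s : Set D)
    (hd : ∀ f g : D →ₐ[k] (TwoSidedIdeal.span s).ringCon.Quotient,
      (∀ p q, f (d p q) = g (d p q)) → f = g)
    (hs : ∀ x ∈ s, φ x = 0)
    (hlin : ∀ c : Fin n → Fin n → k, ∑ i, ∑ j, c i j • T i j = 0 →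
      ∑ i, ∑ j, c i j • d i j ∈ s)
    (hx : ∀ p q m l, quotMk k (TwoSidedIdeal.span s) (d p q * d m l) =
      quotMk k (TwoSidedIdeal.span s) (exchange ℛ (T.map j) d p q m l)) :
    TwoSidedIdeal.ker φ = TwoSidedIdeal.span s := by
  obtain ⟨ψ, hψ⟩ := exists_lift_env hT ℛ j hℛ (d.map (quotMk k (TwoSidedIdeal.span s)))
    (fun c hc => by
      have h := (quotMk_eq_zero (k := k) _).2 (TwoSidedIdeal.subset_span (hlin c hc))
      simp only [map_sum, map_smul] at h
      exact h)
    (fun p q m l => by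
      rw [← map_exchange, ← hx, map_mul]
      rfl)
  refine ker_eq_span φ s hs ψ (hd _ _ fun p q => ?_)
  rw [AlgHom.comp_apply, hφ, hψ]
  rfl

end Env

/-! ### Koszul duality for finite-dimensional coalgebras -/

section Koszul

variable {L : Type*} [AddCommGroup L] [Module k L] [Coalgebra k L] [FiniteDimensional k L]
  (ℛ : A ⊗[k] A →ₗ[k] k) (j : L →ₗc[k] A)

lemma perp_envRel_eq_extRel (hℛ : IsCoquasitriangular ℛ) : perp (envRel ℛ j) = extRel ℛ j := by
  obtain ⟨T, hT⟩ := IsComatrix.exists_of_finiteDimensional (k := k) (L := L)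
  exact perp_envRel hT ℛ j hℛ

lemma exists_koszulDual_env_equiv (hℛ : IsCoquasitriangular ℛ) :
    ∃ e : KoszulDual (envRel ℛ j) ≃ₐ[k] QuadAlg (extRel ℛ j),
      ∀ f : Module.Dual k L, e (QuadAlg.gen _ f) = QuadAlg.gen _ f :=
  QuadAlg.exists_equiv_of_eq _ (perp_envRel_eq_extRel ℛ j hℛ)

lemma exists_env_equiv_koszulDual (hℛ : IsCoquasitriangular ℛ) :
    ∃ e : Env ℛ j ≃ₐ[k] KoszulDual (extRel ℛ j), ∀ x : L, e (QuadAlg.gen _ x) =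
      QuadAlg.gen (perp (extRel ℛ j)) (Module.Dual.eval k L x) := by
  rw [← perp_envRel_eq_extRel ℛ j hℛ]
  exact exists_equiv_koszulDual_perp _

lemma exists_env_to_koszulDual (hℛ : IsCoquasitriangular ℛ)
    (W : Submodule k (Module.Dual k L)) :
    ∃ π : Env ℛ j →ₐ[k] KoszulDual (extRelOn ℛ j W),
      (∀ x : L, π (QuadAlg.gen _ x) =
        QuadAlg.gen (perp (extRelOn ℛ j W)) (Module.Dual.eval k L x ∘ₗ W.subtype)) ∧
      Function.Surjective π ∧
      TwoSidedIdeal.ker π = TwoSidedIdeal.span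
        (QuadAlg.gen (envRel ℛ j) '' {x : L | ∀ f ∈ W, f x = 0}) ∧
      (W = ⊤ → Function.Bijective π) := by
  rw [extRelOn, ← perp_envRel_eq_extRel ℛ j hℛ]
  exact exists_koszulDual_comap _ _

lemma braidedKilling_eq {ι : Type*} [Fintype ι] (e : Module.Basis ι k L) (x y : L) :
    braidedKilling ℛ j x y = ∑ i, LinearMap.mul' k k (TensorProduct.map (e.coord i)
      (killingWeight ℛ (j x) (j y)) (adR j (e i))) := by
  obtain ⟨T, hT⟩ := IsComatrix.exists_of_finiteDimensional (k := k) (L := L)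
  exact braidedKilling_eq_sum hT ℛ j e x y

end Koszul

lemma isComatrix_entry {n : ℕ} (t : Matrix (Fin n) (Fin n) A) (ht : IsMatrixCorep k t) :
    IsComatrix k (Matrix.of (entry t ht) : Matrix (Fin n) (Fin n) (matrixSubcoalgebra t ht)) where
  comul_eq i j := by
    apply (matrixSubcoalgebra t ht).map_subtype_injective
    refine ((matrixSubcoalgebra t ht).map_comulL _).trans ?_
    rw [map_sum]
    exact ht.comul_eq i j
  counit_eq i j := ht.counit_eq i j
  span_eq := by
    apply Submodule.map_injective_of_injective (matrixSubcoalgebra t ht).carrier.injective_subtype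
    rw [Submodule.map_span, ← Set.range_comp, Submodule.map_top, Submodule.range_subtype]
    rfl

/-! ### Braided matrices -/

namespace BraidedMatrices

variable {n : ℕ} (R : Matrix (Fin n × Fin n) (Fin n × Fin n) k)

lemma algHom_ext {D : Type*} [Ring D] [Algebra k D] (f g : BraidedMatrices R →ₐ[k] D)
    (h : ∀ i j, f (gen R i j) = g (gen R i j)) : f = g := by
  apply RingQuot.ringQuot_ext'
  apply FreeAlgebra.hom_ext
  ext p
  exact h p.1 p.2

lemma reflLeft_gen (p q : Fin n × Fin n) :
    reflLeft R (Matrix.of (gen R)) p q = reflRight R (Matrix.of (gen R)) p q := by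
  have h := RingQuot.mkAlgHom_rel k (s := fun x y : FreeAlgebra k (Fin n × Fin n) =>
    ∃ p q, x = reflLeft R (freeGen k n) p q ∧ y = reflRight R (freeGen k n) p q) ⟨p, q, rfl, rfl⟩
  rw [map_reflLeft, map_reflRight] at h
  exact h

lemma exists_lift {D : Type*} [Ring D] [Algebra k D] (v : Matrix (Fin n) (Fin n) D)
    (hv : ∀ p q, reflLeft R v p q = reflRight R v p q) :
    ∃ π : BraidedMatrices R →ₐ[k] D, ∀ i j, π (gen R i j) = v i j := by
  have hm : (freeGen k n).map (FreeAlgebra.lift k fun p : Fin n × Fin n => v p.1 p.2) = v := by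
    ext i j
    simp [freeGen]
  refine ⟨RingQuot.liftAlgHom k ⟨FreeAlgebra.lift k fun p => v p.1 p.2, ?_⟩, fun i j => ?_⟩
  · rintro _ _ ⟨p, q, rfl, rfl⟩
    rw [map_reflLeft, map_reflRight, hm, hv]
  · rw [gen, RingQuot.liftAlgHom_mkAlgHom_apply]
    simp [freeGen]

end BraidedMatrices

end Hopf

end BraidedLie

end

theorem corollary4p5 {k : Type*} [Field k] {A : Type*} [Ring A] [HopfAlgebra k A]
    (ℛ : A ⊗[k] A →ₗ[k] k) (hℛ : IsCoquasitriangular ℛ) :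
    -- finite-dimensional subcoalgebras
    (∀ (L : Subcoalgebra k A) [FiniteDimensional k L],
      -- the Koszul dual of `U(L)` is the quadratic exterior algebra on `L*`, and conversely
      (∃ e : KoszulDual (envRel ℛ L.incl) ≃ₐ[k]
            QuadAlg (extRel ℛ L.incl),
          ∀ f : Module.Dual k L, e (QuadAlg.gen _ f) = QuadAlg.gen _ f) ∧
      (∃ e : Env ℛ L.incl ≃ₐ[k]
            KoszulDual (extRel ℛ L.incl),
          ∀ x : L, e (QuadAlg.gen _ x) =
            QuadAlg.gen (perp (extRel ℛ L.incl)) (Module.Dual.eval k L x)) ∧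
      -- the calculus with `Λ¹ = ϖ(A⁺)`
      (∃ π : Env ℛ L.incl →ₐ[k]
            KoszulDual (extRelOn ℛ L.incl (oneForms ℛ L.incl)),
          (∀ x : L, π (QuadAlg.gen _ x) =
            QuadAlg.gen (perp (extRelOn ℛ L.incl (oneForms ℛ L.incl)))
              (Module.Dual.eval k L x ∘ₗ (oneForms ℛ L.incl).subtype)) ∧
          Function.Surjective π ∧
          TwoSidedIdeal.ker π = TwoSidedIdeal.span (QuadAlg.gen (envRel ℛ L.incl) ''
            {x : L | ∀ f ∈ oneForms ℛ L.incl, f x = 0}) ∧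
          (oneForms ℛ L.incl = ⊤ → Function.Bijective π)) ∧
      -- the braided-Killing form
      (∀ (m : ℕ) (e : Module.Basis (Fin m) k L) (a b : L),
        braidedKilling ℛ L.incl a b =
          ∑ i, LinearMap.mul' k k (TensorProduct.map (e.coord i)
            (killingWeight ℛ (a : A) (b : A)) (adR L.incl (e i))))) ∧
    -- matrix subcoalgebras
    (∀ (n : ℕ) (t : Matrix (Fin n) (Fin n) A) (ht : IsMatrixCorep k t),
      let L := matrixSubcoalgebra t ht
      let T : Matrix (Fin n) (Fin n) L := Matrix.of (entry t ht)
      let R := rMatrix ℛ t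
      let R' := rTilde ℛ t
      let τ : Matrix (Fin n) (Fin n) (Env ℛ L.incl) :=
        T.map (QuadAlg.gen (envRel ℛ L.incl))
      let φ : FreeAlgebra k (Fin n × Fin n) →ₐ[k] Env ℛ L.incl :=
        FreeAlgebra.lift k fun p => τ p.1 p.2
      IsUnit R ∧
      -- the bracket
      (∀ i j m l, bracket ℛ L.incl (T i j ⊗ₜ T m l) =
        ∑ k₁, ∑ k₂, ∑ k₃, ∑ k₄, ∑ i₁, ∑ i₂, ∑ i₃,
          (R⁻¹ (k₁, i) (k₂, i₁) * R (k₃, i₁) (k₄, i₂) * R (i₂, k₄) (i₃, l) *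
            R' (i₃, m) (j, k₁)) • T k₂ k₃) ∧
      -- the categorical braiding
      (∀ i j m l, catBraiding ℛ L.incl (T i j ⊗ₜ T m l) =
        ∑ k₁, ∑ k₂, ∑ k₃, ∑ k₄, ∑ i₁, ∑ i₂, ∑ i₃, ∑ i₄,
          (R (i, k₁) (i₁, k₂) * R⁻¹ (i₁, k₃) (i₂, k₄) * R (i₃, k₄) (i₄, l) *
            R' (i₄, m) (j, k₁)) • (T k₂ k₃ ⊗ₜ[k] T i₂ i₃)) ∧
      -- generators and relations of `U(L)`
      (∀ i j m l, τ i j * τ m l = exchange ℛ t τ i j m l) ∧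
      Function.Surjective φ ∧
      TwoSidedIdeal.ker φ = TwoSidedIdeal.span
        ({x | ∃ i j m l, x = freeGen k n i j * freeGen k n m l -
            exchange ℛ t (freeGen k n) i j m l} ∪
          linRel (k := k) t (freeGen k n)) ∧
      -- the compact form of the relations, and the braided matrices
      reflLeft R τ = reflRight R τ ∧
      (∃ π : BraidedMatrices R →ₐ[k] Env ℛ L.incl,
        (∀ i j, π (BraidedMatrices.gen R i j) = τ i j) ∧
        Function.Surjective π ∧
        TwoSidedIdeal.ker π = TwoSidedIdeal.span
          (linRel (k := k) t (Matrix.of (BraidedMatrices.gen R))) ∧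
        (LinearIndependent k (fun p : Fin n × Fin n => t p.1 p.2) → Function.Bijective π))) := by
  refine ⟨fun L _ => ?_, fun n t ht => ?_⟩
  · exact ⟨exists_koszulDual_env_equiv ℛ L.incl hℛ, exists_env_equiv_koszulDual ℛ L.incl hℛ,
      exists_env_to_koszulDual ℛ L.incl hℛ _, fun m e a b => braidedKilling_eq ℛ L.incl e a b⟩
  · intro L T R R' τ φ
    have hT : IsComatrix k T := isComatrix_entry t ht
    have hx : ∀ i j m l, τ i j * τ m l = exchange ℛ t τ i j m l := gen_mul_gen hT ℛ L.incl hℛ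
    have hrefl : ∀ p q, reflLeft R τ p q = reflRight R τ p q :=
      (reflLeft_eq_reflRight_iff ht hℛ τ).2 hx
    -- The inclusion of the subcoalgebra is injective, so linear relations among the entries are the
    -- same in `A` and in `L`.
    have hlin (c : Fin n → Fin n → k) :
        ∑ i, ∑ j, c i j • t i j = 0 ↔ ∑ i, ∑ j, c i j • T i j = 0 := by
      rw [← (L.carrier.injective_subtype).eq_iff, map_zero]
      simp only [map_sum, map_smul]
      rfl
    have hτ (c : Fin n → Fin n → k) (hc : ∑ i, ∑ j, c i j • t i j = 0) :
        ∑ i, ∑ j, c i j • τ i j = 0 := by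
      have h := congrArg (QuadAlg.gen (envRel ℛ L.incl)) ((hlin c).1 hc)
      simp only [map_sum, map_smul, map_zero] at h
      exact h
    have hφ (i j) : φ (freeGen k n i j) = τ i j := FreeAlgebra.lift_ι_apply _ _
    have hφ' : (freeGen k n).map φ = τ := Matrix.ext hφ
    obtain ⟨π, hπ⟩ := BraidedMatrices.exists_lift R τ hrefl
    have hπs : Function.Surjective π := hT.surjective_env π _ hπ
    have hπk : TwoSidedIdeal.ker π = TwoSidedIdeal.span
        (linRel (k := k) t (Matrix.of (BraidedMatrices.gen R))) := by
      -- The exchange relations hold in B(R) itself, being equivalent to the reflection equation, so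
      -- only the linear relations remain to generate the kernel.
      refine ker_eq_span_of_relations hT ℛ L.incl hℛ π (Matrix.of (BraidedMatrices.gen R)) hπ _
        (fun f g => BraidedMatrices.algHom_ext R f g) ?_ (fun c hc => ⟨c, (hlin c).2 hc, rfl⟩)
        fun p q m l => congrArg _ ((reflLeft_eq_reflRight_iff ht hℛ _).1
          (BraidedMatrices.reflLeft_gen R) p q m l)
      rintro _ ⟨c, hc, rfl⟩
      simp only [map_sum, map_smul, Matrix.of_apply, hπ, hτ c hc]
    have hφs : Function.Surjective φ := hT.surjective_env φ (freeGen k n) hφ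
    refine ⟨isUnit_rMatrix ht hℛ, bracket_entry hT ℛ L.incl hℛ, catBraiding_entry hT ℛ L.incl hℛ,
      hx, hφs, ?_, Matrix.ext fun p q => hrefl p q, π, hπ, hπs, hπk,
      fun hli => ⟨injective_of_ker_eq_span π _ hπk ?_, hπs⟩⟩
    · refine ker_eq_span_of_relations hT ℛ L.incl hℛ φ (freeGen k n) hφ _ (fun f g h => ?_) ?_
        (fun c hc => Or.inr ⟨c, (hlin c).2 hc, rfl⟩) fun p q m l => ?_
      · apply FreeAlgebra.hom_ext
        ext p
        exact h p.1 p.2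
      · rintro _ (⟨i, j, m, l, rfl⟩ | ⟨c, hc, rfl⟩)
        · rw [map_sub, map_mul, map_exchange, hφ', hφ, hφ, hx, sub_self]
        · simp only [map_sum, map_smul, hφ, hτ c hc]
      · rw [← sub_eq_zero, ← map_sub, quotMk_eq_zero]
        exact TwoSidedIdeal.subset_span (Or.inl ⟨p, q, m, l, rfl⟩)
    · rintro _ ⟨c, hc, rfl⟩
      have h0 := Fintype.linearIndependent_iff.1 hli (fun p => c p.1 p.2)
        (by rw [Fintype.sum_prod_type]; exact hc)
      simp only [fun i j => h0 (i, j), zero_smul, Finset.sum_const_zero]
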